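/- Let $\mathcal O=\mathbb C\{x,y\}$ be the ring of convergent power series in two variables. For $f\in\mathcal O$ let $J_f=\langle \partial f/\partial x,\partial f/\partial y\rangle$, and put $\mu(f)=\dim_{\mathbb C}\mathcal O/J_f$ (Milnor number), $\tau(f)=\dim_{\mathbb C}\mathcal O/(\langle f\rangle+J_f)$ (Tjurina number) and $\rho(f)=\mu(f)/\tau(f)$. We say that $f$ defines an isolated plane curve singularity if $f$, $\partial f/\partial x$, $\partial f/\partial y$ all vanish at the origin and have no other common zero in some neighbourhood of it. There is a sequence of isolated plane curve singularities, with finite Milnor and Tjurina numbers, for which the sequence of rational numbers $\rho$ is strictly increasing with limit $4/3$. Moreover, the singularities can be chosen to be all irreducible, or all to consist of smooth branches with pairwise distinct tangents. More precisely: (a) For every integer $m\ge 2$ the series $f=x^{2m+1}+x^my^{m+1}+y^{2m}$ defines an isolated plane curve singularity and is irreducible in $\mathcal O$; the algebras $\mathcal O/J_f$ and $\mathcal O/(\langle f\rangle+J_f)$ are finite-dimensional, with $\tau(f)=3m^2$ and $\mu(f)=2m(2m-1)$. The numbers $\rho(f)$ are strictly increasing in $m\ge 2$ and tend to $4/3$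 as $m\to\infty$. (b) For every integer $m\ge 1$ the series $f=x^{2m+1}+y^{2m+1}+x^{m+1}y^{m+1}$ defines an isolated plane curve singularity all of whose branches are smooth, with pairwise distinct tangents (that is, up to a unit of $\mathcal O$, $f$ is a product of irreducible elements of $\mathcal O$ with nonzero gradients at the origin, pairwise linearly independent); the algebras $\mathcal O/J_f$ and $\mathcal O/(\langle f\rangle+J_f)$ are finite-dimensional, with $\mu(f)=4m^2$ and $\tau(f)=4m^2-(m-1)^2$. The numbers $\rho(f)$ are strictly increasing in $m\ge 1$ and tend to $4/3$ as $m\to\infty$. -/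

import Mathlib

open Filter Topology

namespace PlaneCurve

noncomputable section

/-- A formal power series `φ = ∑ aₙ x^{n₀} y^{n₁}` is convergent if it converges absolutely on
some polydisc of radius `r > 0` around the origin. -/
def IsConvergent (φ : MvPowerSeries (Fin 2) ℂ) : Prop :=
  ∃ r : ℝ, 0 < r ∧
    Summable fun n : Fin 2 →₀ ℕ => ‖MvPowerSeries.coeff n φ‖ * r ^ (n 0 + n 1)

lemma isConvergent_monomial (d : Fin 2 →₀ ℕ) (a : ℂ) :
    IsConvergent (MvPowerSeries.monomial d a) := by
  classical
  refine ⟨1, one_pos, summable_of_ne_finset_zero (s := {d}) ?_⟩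
  intro n hn
  have hnd : n ≠ d := by simpa using hn
  simp [MvPowerSeries.coeff_monomial, hnd]

lemma IsConvergent.smaller {φ : MvPowerSeries (Fin 2) ℂ} {r s : ℝ} (hs : 0 ≤ s) (hsr : s ≤ r)
    (h : Summable fun n : Fin 2 →₀ ℕ => ‖MvPowerSeries.coeff n φ‖ * r ^ (n 0 + n 1)) :
    Summable fun n : Fin 2 →₀ ℕ => ‖MvPowerSeries.coeff n φ‖ * s ^ (n 0 + n 1) := by
  refine Summable.of_nonneg_of_le (fun n => by positivity) (fun n => ?_) h
  gcongr

lemma IsConvergent.add {φ ψ : MvPowerSeries (Fin 2) ℂ} (hφ : IsConvergent φ)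
    (hψ : IsConvergent ψ) : IsConvergent (φ + ψ) := by
  obtain ⟨r, hr, h1⟩ := hφ
  obtain ⟨s, hs, h2⟩ := hψ
  have ht : 0 < min r s := lt_min hr hs
  refine ⟨min r s, ht, ?_⟩
  refine Summable.of_nonneg_of_le (fun n => by positivity) (fun n => ?_)
    ((IsConvergent.smaller ht.le (min_le_left r s) h1).add
      (IsConvergent.smaller ht.le (min_le_right r s) h2))
  rw [map_add, ← add_mul]
  gcongr
  exact norm_add_le _ _

lemma IsConvergent.mul {φ ψ : MvPowerSeries (Fin 2) ℂ} (hφ : IsConvergent φ)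
    (hψ : IsConvergent ψ) : IsConvergent (φ * ψ) := by
  classical
  obtain ⟨r, hr, h1⟩ := hφ
  obtain ⟨s, hs, h2⟩ := hψ
  have ht : 0 < min r s := lt_min hr hs
  refine ⟨min r s, ht, ?_⟩
  set t := min r s
  have h1' := IsConvergent.smaller ht.le (min_le_left r s) h1
  have h2' := IsConvergent.smaller ht.le (min_le_right r s) h2
  have h3 : Summable fun n : Fin 2 →₀ ℕ => ∑ p ∈ Finset.HasAntidiagonal.antidiagonal n,
      (‖MvPowerSeries.coeff p.1 φ‖ * t ^ (p.1 0 + p.1 1)) *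
        (‖MvPowerSeries.coeff p.2 ψ‖ * t ^ (p.2 0 + p.2 1)) := by
    refine summable_sum_mul_antidiagonal_of_summable_mul
      (f := fun n : Fin 2 →₀ ℕ => ‖MvPowerSeries.coeff n φ‖ * t ^ (n 0 + n 1))
      (g := fun n : Fin 2 →₀ ℕ => ‖MvPowerSeries.coeff n ψ‖ * t ^ (n 0 + n 1)) ?_
    exact Summable.mul_of_nonneg h1' h2' (fun n => by dsimp; positivity)
      (fun n => by dsimp; positivity)
  refine Summable.of_nonneg_of_le (fun n => by positivity) (fun n => ?_) h3
  rw [MvPowerSeries.coeff_mul]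
  refine (mul_le_mul_of_nonneg_right (norm_sum_le _ _) (by positivity)).trans ?_
  rw [Finset.sum_mul]
  refine Finset.sum_le_sum fun p hp => ?_
  have h0 : n 0 = p.1 0 + p.2 0 := by
    rw [← Finset.HasAntidiagonal.mem_antidiagonal.mp hp, Finsupp.add_apply]
  have h1 : n 1 = p.1 1 + p.2 1 := by
    rw [← Finset.HasAntidiagonal.mem_antidiagonal.mp hp, Finsupp.add_apply]
  rw [h0, h1, norm_mul]
  refine le_of_eq ?_
  ring

lemma IsConvergent.pderiv {φ : MvPowerSeries (Fin 2) ℂ} (hφ : IsConvergent φ) (i : Fin 2) :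
    IsConvergent (MvPowerSeries.pderiv ℂ i φ) := by
  obtain ⟨r, hr, h⟩ := hφ
  refine ⟨r / 2, by positivity, ?_⟩
  have hinj : Function.Injective fun n : Fin 2 →₀ ℕ => n + Finsupp.single i 1 :=
    fun a b hab => by simpa using hab
  have h2 := (h.comp_injective hinj).mul_left r⁻¹
  refine Summable.of_nonneg_of_le (fun n => by positivity) (fun n => ?_) h2
  have hdeg : (n + Finsupp.single i 1 : Fin 2 →₀ ℕ) 0 + (n + Finsupp.single i 1 : Fin 2 →₀ ℕ) 1
      = n 0 + n 1 + 1 := by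
    rw [Finsupp.add_apply, Finsupp.add_apply]
    fin_cases i
    · simp; omega
    · simp; omega
  have hle : (n i : ℝ) + 1 ≤ 2 ^ (n 0 + n 1) := by
    have h3 : n i + 1 ≤ n 0 + n 1 + 1 := by fin_cases i <;> simp
    have h4 : n i + 1 ≤ 2 ^ (n 0 + n 1) := h3.trans Nat.lt_two_pow_self
    exact_mod_cast h4
  simp only [Function.comp_apply]
  rw [hdeg, MvPowerSeries.coeff_pderiv, norm_mul]
  have hn : ‖((n i : ℂ) + 1)‖ = (n i : ℝ) + 1 := by
    rw [← Nat.cast_succ, Complex.norm_natCast, Nat.cast_succ]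
  rw [hn, div_pow, pow_succ]
  have e : r⁻¹ * (‖MvPowerSeries.coeff (n + Finsupp.single i 1) φ‖ * (r ^ (n 0 + n 1) * r))
      = ‖MvPowerSeries.coeff (n + Finsupp.single i 1) φ‖ * 2 ^ (n 0 + n 1)
        * (r ^ (n 0 + n 1) / 2 ^ (n 0 + n 1)) := by
    field_simp
  rw [e]
  gcongr

/-- The local ring `𝒪 = ℂ{x, y}` of germs at the origin of holomorphic functions on `ℂ²`,
as the ring of convergent power series in two variables. -/
def localRing : Subalgebra ℂ (MvPowerSeries (Fin 2) ℂ) where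
  carrier := {φ | IsConvergent φ}
  mul_mem' := fun h1 h2 => h1.mul h2
  add_mem' := fun h1 h2 => h1.add h2
  algebraMap_mem' := fun a => isConvergent_monomial 0 a

/-- The coordinate function `x`. -/
def x : localRing := ⟨MvPowerSeries.X 0, isConvergent_monomial _ 1⟩

/-- The coordinate function `y`. -/
def y : localRing := ⟨MvPowerSeries.X 1, isConvergent_monomial _ 1⟩

/-- The partial derivative of a germ: `∂ 0 = ∂/∂x`, `∂ 1 = ∂/∂y`. -/
def partialDeriv (i : Fin 2) (f : localRing) : localRing :=
  ⟨MvPowerSeries.pderiv ℂ i f.1, IsConvergent.pderiv f.2 i⟩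

/-- The value at the origin. -/
def valueAtZero (f : localRing) : ℂ := MvPowerSeries.constantCoeff f.1

/-- The sum of the power series at the point `p` (meaningful for `p` near the origin, where the
series converges absolutely). -/
def value (f : localRing) (p : Fin 2 → ℂ) : ℂ :=
  ∑' n : Fin 2 →₀ ℕ, MvPowerSeries.coeff n f.1 * (p 0 ^ n 0 * p 1 ^ n 1)

/-- The germ `(X, 0)` defined by `f = 0` is an isolated plane curve singularity: it passes through
the origin, is singular there, and the origin is an isolated point of its singular locus
`f = ∂f/∂x = ∂f/∂y = 0`. -/
def IsIsolatedSingularity (f : localRing) : Prop :=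
  valueAtZero f = 0 ∧ (∀ i, valueAtZero (partialDeriv i f) = 0) ∧
    ∀ᶠ p in 𝓝[≠] (0 : Fin 2 → ℂ), ¬ (value f p = 0 ∧ ∀ i, value (partialDeriv i f) p = 0)

/-- The Jacobian ideal, generated by the partial derivatives. -/
def jacobianIdeal (f : localRing) : Ideal localRing :=
  Ideal.span {partialDeriv 0 f, partialDeriv 1 f}

/-- The Milnor algebra `𝒪 / J_f`. -/
abbrev MilnorAlgebra (f : localRing) : Type := localRing ⧸ jacobianIdeal f

/-- The Tjurina algebra `𝒪 / (⟨f⟩ + J_f)`. -/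
abbrev TjurinaAlgebra (f : localRing) : Type := localRing ⧸ (Ideal.span {f} ⊔ jacobianIdeal f)

/-- The Milnor number `μ`. -/
def milnorNumber (f : localRing) : ℕ := Module.finrank ℂ (MilnorAlgebra f)

/-- The Tjurina number `τ`. -/
def tjurinaNumber (f : localRing) : ℕ := Module.finrank ℂ (TjurinaAlgebra f)

/-- The quotient `ρ = μ / τ`. -/
def rho (f : localRing) : ℚ := (milnorNumber f : ℚ) / (tjurinaNumber f : ℚ)

/-- The curve germ `g = 0` is smooth at the origin. -/
def IsSmoothGerm (g : localRing) : Prop :=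
  valueAtZero g = 0 ∧ ∃ i, valueAtZero (partialDeriv i g) ≠ 0

/-- The tangent lines at the origin of the smooth germs `g = 0` and `h = 0` are distinct:
the gradients of `g` and `h` at the origin are linearly independent. -/
def HasDistinctTangents (g h : localRing) : Prop :=
  LinearIndependent ℂ
    ![fun i : Fin 2 => valueAtZero (partialDeriv i g), fun i => valueAtZero (partialDeriv i h)]

/-- The curve germ `f = 0` consists of smooth branches with pairwise distinct tangents: up to a
unit, `f` is a product of irreducible germs (the equations of the branches) which are smooth and
have pairwise distinct tangent lines. -/
def HasSmoothTransversalBranches (f : localRing) : Prop :=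
  ∃ (r : ℕ) (g : Fin r → localRing),
    Associated f (∏ j, g j) ∧ (∀ j, Irreducible (g j)) ∧ (∀ j, IsSmoothGerm (g j)) ∧
      ∀ j k, j ≠ k → HasDistinctTangents (g j) (g k)

/-- `x^{2m+1} + x^m y^{m+1} + y^{2m}`. -/
def irreducibleFamily (m : ℕ) : localRing :=
  x ^ (2 * m + 1) + x ^ m * y ^ (m + 1) + y ^ (2 * m)

/-- `x^{2m+1} + y^{2m+1} + x^{m+1} y^{m+1}`. -/
def transversalFamily (m : ℕ) : localRing :=
  x ^ (2 * m + 1) + y ^ (2 * m + 1) + x ^ (m + 1) * y ^ (m + 1)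

end

end PlaneCurve

namespace PlaneCurve

noncomputable section

open scoped ENNReal NNReal

/-! ### Coefficients and the value at the origin -/

/-! Both families are semi-quasihomogeneous: for weights `a`, `b` of `x`, `y`, the partial
derivatives are, up to nonzero constants, `u = x^p + …` and `v = y^q + …`, where the dots have
higher weight. The monomials below `x^p` and `y^q` then form a basis of `𝒪 / J_f`, so `μ = pq`. They
span because a monomial divisible by `x^p` or `y^q` can be traded modulo `(u, v)` for terms of
higher weight, and everything of weight at least `ap + bq` lies in `(u, v)` by Nakayama. They are
independent because the pair `(Q, R)` in a relation `Qu + Rv = f` can be pushed to arbitrarily high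
weight by Koszul syzygies (`eq_zero_of_mem_span_pair`).

The combination `f - xu - yv` is a nonzero multiple of one monomial `w = x^s y^t`, so the Tjurina
ideal is `(w) + J_f`. The annihilator of `w` in `𝒪 / J_f` contains germs with corners `x^(p-s)` and
`y^(q-t)`, obtained from syzygies of `u` and `v`. Hence exactly the rectangle of monomials divisible
by `w` is lost: `τ = pq - (p-s)(q-t)` (`milnor_tjurina_of_corners`). The subtracted term is `m(m-2)`
in the first family and `(m-1)^2` in the second, asymptotically a quarter of `μ`, whence the limit
`4/3`.

Irreducibility of the first family comes from its Newton polygon, a single edge from `(2m+1, 0)` to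
`(0, 2m)` with coprime lengths. The second family splits by Hensel's lemma: substituting `x = yt`
gives `y^(2m+1) (t^(2m+1) + 1 + y t^(m+1))`, and the roots of `t^(2m+1) = -1` are simple. Hensel's
lemma for convergent series is proved by a contraction argument with majorant norms; it also gives
the inverses needed to apply Nakayama. -/

/-- The coefficient of `x ^ n 0 * y ^ n 1`. -/
def coef (n : Fin 2 →₀ ℕ) : localRing →ₗ[ℂ] ℂ :=
  (MvPowerSeries.coeff n).comp localRing.val.toLinearMap

lemma coef_apply (n : Fin 2 →₀ ℕ) (f : localRing) : coef n f = MvPowerSeries.coeff n f.1 := rfl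

lemma localRing_ext {f g : localRing} (h : ∀ n, coef n f = coef n g) : f = g :=
  Subtype.ext (MvPowerSeries.ext h)

lemma coef_mul (n : Fin 2 →₀ ℕ) (f g : localRing) :
    coef n (f * g) =
      ∑ p ∈ Finset.HasAntidiagonal.antidiagonal n, coef p.1 f * coef p.2 g := by
  classical
  exact MvPowerSeries.coeff_mul n f.1 g.1

/-- The value at the origin as an algebra homomorphism. -/
def valueAtZeroHom : localRing →ₐ[ℂ] ℂ where
  toFun := valueAtZero
  map_one' := by simp [valueAtZero]
  map_mul' f g := by simp [valueAtZero]
  map_zero' := by simp [valueAtZero]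
  map_add' f g := by simp [valueAtZero]
  commutes' c := by simp [valueAtZero, MvPowerSeries.algebraMap_apply]

lemma valueAtZeroHom_apply (f : localRing) : valueAtZeroHom f = valueAtZero f := rfl

lemma coef_zero (f : localRing) : coef 0 f = valueAtZero f := rfl

@[simp] lemma valueAtZero_x : valueAtZero x = 0 := by simp [valueAtZero, x]

@[simp] lemma valueAtZero_y : valueAtZero y = 0 := by simp [valueAtZero, y]

@[simp] lemma valueAtZeroHom_x : valueAtZeroHom x = 0 := valueAtZero_x

@[simp] lemma valueAtZeroHom_y : valueAtZeroHom y = 0 := valueAtZero_y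

/-- The exponent of the monomial `x ^ i * y ^ j`. -/
def expo (i j : ℕ) : Fin 2 →₀ ℕ := Finsupp.single 0 i + Finsupp.single 1 j

@[simp] lemma expo_zero (i j : ℕ) : expo i j 0 = i := by simp [expo]

@[simp] lemma expo_one (i j : ℕ) : expo i j 1 = j := by simp [expo]

lemma expo_eta (n : Fin 2 →₀ ℕ) : expo (n 0) (n 1) = n := by
  ext i; fin_cases i <;> simp

lemma exponent_ext {n m : Fin 2 →₀ ℕ} (h0 : n 0 = m 0) (h1 : n 1 = m 1) : n = m := by
  ext i; fin_cases i <;> assumption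

lemma xy_val (i j : ℕ) : (x ^ i * y ^ j).1 = MvPowerSeries.monomial (expo i j) 1 := by
  have : (x ^ i * y ^ j).1 = MvPowerSeries.X 0 ^ i * MvPowerSeries.X 1 ^ j := rfl
  rw [this, MvPowerSeries.X_pow_eq, MvPowerSeries.X_pow_eq, MvPowerSeries.monomial_mul_monomial,
    one_mul, expo]

lemma coef_xy (n : Fin 2 →₀ ℕ) (i j : ℕ) :
    coef n (x ^ i * y ^ j) = if n 0 = i ∧ n 1 = j then 1 else 0 := by
  classical
  rw [coef_apply, xy_val, MvPowerSeries.coeff_monomial]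
  refine if_congr ⟨?_, ?_⟩ rfl rfl
  · rintro rfl; simp
  · rintro ⟨h0, h1⟩
    exact exponent_ext (by simp [h0]) (by simp [h1])

lemma coef_mul_xy (n : Fin 2 →₀ ℕ) (f : localRing) (i j : ℕ) :
    coef n (f * (x ^ i * y ^ j)) =
      if i ≤ n 0 ∧ j ≤ n 1 then coef (expo (n 0 - i) (n 1 - j)) f else 0 := by
  classical
  have : (f * (x ^ i * y ^ j)).1 = f.1 * (x ^ i * y ^ j).1 := rfl
  rw [coef_apply, this, xy_val, MvPowerSeries.coeff_mul_monomial, mul_one]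
  refine if_congr ⟨fun h => ⟨by simpa using h 0, by simpa using h 1⟩, fun h k => ?_⟩ ?_ rfl
  · fin_cases k
    · simpa using h.1
    · simpa using h.2
  · rw [coef_apply]
    congr 1
    congr 1
    exact exponent_ext (by simp) (by simp)

/-! ### Majorant norms -/

/-- The sum of the absolute values of the coefficients on the polydisc of radius `r`. -/
def majorant (r : ℝ≥0) (φ : MvPowerSeries (Fin 2) ℂ) : ℝ≥0∞ :=
  ∑' n : Fin 2 →₀ ℕ, ‖MvPowerSeries.coeff n φ‖ₑ * (r : ℝ≥0∞) ^ (n 0 + n 1)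

lemma majorant_term (r : ℝ≥0) (φ : MvPowerSeries (Fin 2) ℂ) (n : Fin 2 →₀ ℕ) :
    ‖MvPowerSeries.coeff n φ‖ₑ * (r : ℝ≥0∞) ^ (n 0 + n 1) =
      ENNReal.ofReal (‖MvPowerSeries.coeff n φ‖ * (r : ℝ) ^ (n 0 + n 1)) := by
  rw [ENNReal.ofReal_mul (norm_nonneg _), ofReal_norm, ENNReal.ofReal_pow r.coe_nonneg,
    ENNReal.ofReal_coe_nnreal]

lemma majorant_ne_top_iff (r : ℝ≥0) (φ : MvPowerSeries (Fin 2) ℂ) :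
    majorant r φ ≠ ∞ ↔
      Summable fun n : Fin 2 →₀ ℕ => ‖MvPowerSeries.coeff n φ‖ * (r : ℝ) ^ (n 0 + n 1) := by
  simp only [majorant, majorant_term]
  constructor
  · intro h
    have := ENNReal.summable_toReal h
    refine this.congr fun n => ?_
    rw [ENNReal.toReal_ofReal (by positivity)]
  · intro h
    exact h.tsum_ofReal_ne_top

lemma isConvergent_iff (φ : MvPowerSeries (Fin 2) ℂ) :
    IsConvergent φ ↔ ∃ r : ℝ≥0, 0 < r ∧ majorant r φ ≠ ∞ := by
  constructor
  · rintro ⟨r, hr, h⟩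
    exact ⟨⟨r, hr.le⟩, hr, (majorant_ne_top_iff _ _).2 h⟩
  · rintro ⟨r, hr, h⟩
    exact ⟨r, hr, (majorant_ne_top_iff _ _).1 h⟩

lemma majorant_mono {r s : ℝ≥0} (h : r ≤ s) (φ : MvPowerSeries (Fin 2) ℂ) :
    majorant r φ ≤ majorant s φ := by
  refine ENNReal.tsum_le_tsum fun n => ?_
  gcongr

lemma majorant_add_le (r : ℝ≥0) (φ ψ : MvPowerSeries (Fin 2) ℂ) :
    majorant r (φ + ψ) ≤ majorant r φ + majorant r ψ := by
  simp only [majorant]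
  rw [← ENNReal.tsum_add]
  refine ENNReal.tsum_le_tsum fun n => ?_
  rw [← add_mul, map_add]
  gcongr
  exact enorm_add_le _ _

lemma majorant_mul_le (r : ℝ≥0) (φ ψ : MvPowerSeries (Fin 2) ℂ) :
    majorant r (φ * ψ) ≤ majorant r φ * majorant r ψ := by
  classical
  simp only [majorant]
  rw [← ENNReal.tsum_mul_right]
  simp_rw [← ENNReal.tsum_mul_left]
  rw [← ENNReal.tsum_prod (f := fun a b : Fin 2 →₀ ℕ =>
      ‖MvPowerSeries.coeff a φ‖ₑ * (r : ℝ≥0∞) ^ (a 0 + a 1) *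
      (‖MvPowerSeries.coeff b ψ‖ₑ * (r : ℝ≥0∞) ^ (b 0 + b 1))),
    ← (Finset.HasAntidiagonal.sigmaAntidiagonalEquivProd (A := Fin 2 →₀ ℕ)).tsum_eq,
    ENNReal.tsum_sigma']
  refine ENNReal.tsum_le_tsum fun n => ?_
  rw [tsum_fintype, MvPowerSeries.coeff_mul]
  simp only [Finset.HasAntidiagonal.sigmaAntidiagonalEquivProd_apply]
  rw [Finset.sum_coe_sort (Finset.HasAntidiagonal.antidiagonal n)
    (fun p => ‖MvPowerSeries.coeff p.1 φ‖ₑ * (r : ℝ≥0∞) ^ (p.1 0 + p.1 1) *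
      (‖MvPowerSeries.coeff p.2 ψ‖ₑ * (r : ℝ≥0∞) ^ (p.2 0 + p.2 1)))]
  refine (mul_le_mul_left (enorm_sum_le _ _) _).trans ?_
  rw [Finset.sum_mul]
  refine Finset.sum_le_sum fun p hp => ?_
  obtain rfl := Finset.HasAntidiagonal.mem_antidiagonal.mp hp
  rw [enorm_mul, Finsupp.add_apply, Finsupp.add_apply]
  refine le_of_eq ?_
  ring

lemma majorant_monomial (r : ℝ≥0) (d : Fin 2 →₀ ℕ) (a : ℂ) :
    majorant r (MvPowerSeries.monomial d a) = ‖a‖ₑ * (r : ℝ≥0∞) ^ (d 0 + d 1) := by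
  classical
  rw [majorant, tsum_eq_single d]
  · simp
  · intro n hn
    simp [MvPowerSeries.coeff_monomial, hn]

lemma majorant_pow_le (r : ℝ≥0) (φ : MvPowerSeries (Fin 2) ℂ) (k : ℕ) :
    majorant r (φ ^ k) ≤ majorant r φ ^ k := by
  induction k with
  | zero =>
    have := majorant_monomial r 0 1
    rw [MvPowerSeries.monomial_zero_one] at this
    simp [this]
  | succ k ih =>
    rw [pow_succ, pow_succ]
    exact (majorant_mul_le _ _ _).trans (mul_le_mul_left ih _)

/-- The majorant norm of a germ without constant term is small on small polydiscs. -/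
lemma exists_majorant_le (f : localRing) (hf : valueAtZero f = 0) (ε : ℝ≥0) (hε : 0 < ε) :
    ∃ s : ℝ≥0, 0 < s ∧ ∀ r ≤ s, majorant r f.1 ≤ ε := by
  obtain ⟨R, hR, hfin⟩ := (isConvergent_iff f.1).1 f.2
  lift majorant R f.1 to ℝ≥0 using hfin with M hM
  refine ⟨min R (R * (ε / (M + 1))), lt_min hR (by positivity), fun r hr => ?_⟩
  have hrR : r ≤ R := hr.trans (min_le_left _ _)
  have hq : r / R ≤ ε / (M + 1) := by
    rw [div_le_iff₀ hR, mul_comm]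
    exact hr.trans (min_le_right _ _)
  -- With no constant term, every monomial contributes at least one factor `r / R` when the radius
  -- shrinks from `R` to `r`.
  have key : majorant r f.1 ≤ (r / R : ℝ≥0) * majorant R f.1 := by
    simp only [majorant]
    rw [← ENNReal.tsum_mul_left]
    refine ENNReal.tsum_le_tsum fun n => ?_
    by_cases hn : n 0 + n 1 = 0
    · have : n = 0 := exponent_ext (by simp; omega) (by simp; omega)
      subst this
      have : MvPowerSeries.coeff 0 f.1 = 0 := hf
      simp [this]
    · rw [mul_left_comm]
      gcongr
      norm_cast
      obtain ⟨k, hk⟩ := Nat.exists_eq_succ_of_ne_zero hn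
      rw [hk, pow_succ, pow_succ, div_mul_eq_mul_div, le_div_iff₀ hR]
      have : r ^ k ≤ R ^ k := by gcongr
      calc r ^ k * r * R = r ^ k * (r * R) := by ring
        _ ≤ R ^ k * (r * R) := by gcongr
        _ = _ := by ring
  refine key.trans ?_
  rw [← hM]
  norm_cast
  calc r / R * M ≤ ε / (M + 1) * M := by gcongr
    _ ≤ ε / (M + 1) * (M + 1) := by gcongr; simp
    _ = ε := by field_simp

lemma exists_majorant_lt_top (f : localRing) :
    ∃ s : ℝ≥0, 0 < s ∧ ∀ r ≤ s, majorant r f.1 ≤ majorant s f.1 ∧ majorant s f.1 ≠ ∞ := by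
  obtain ⟨R, hR, hfin⟩ := (isConvergent_iff f.1).1 f.2
  exact ⟨R, hR, fun r hr => ⟨majorant_mono hr _, hfin⟩⟩

/-! ### The weight filtration -/

/-- The germs all of whose monomials `x ^ i * y ^ j` satisfy `a * i + b * j ≥ k`. -/
def weightIdeal (a b k : ℕ) : Ideal localRing where
  carrier := {f | ∀ n : Fin 2 →₀ ℕ, a * n 0 + b * n 1 < k → coef n f = 0}
  zero_mem' := fun n _ => map_zero _
  add_mem' := fun {f g} hf hg n hn => by rw [map_add, hf n hn, hg n hn, add_zero]
  smul_mem' := fun c f hf n hn => by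
    rw [smul_eq_mul, coef_mul]
    refine Finset.sum_eq_zero fun p hp => ?_
    obtain rfl := Finset.HasAntidiagonal.mem_antidiagonal.mp hp
    rw [Finsupp.add_apply, Finsupp.add_apply] at hn
    rw [hf p.2 (by nlinarith), mul_zero]

lemma weightIdeal_anti {a b j k : ℕ} (h : j ≤ k) : weightIdeal a b k ≤ weightIdeal a b j :=
  fun _ hf n hn => hf n (hn.trans_le h)

lemma weightIdeal_zero (a b : ℕ) : weightIdeal a b 0 = ⊤ :=
  eq_top_iff.2 fun _ _ _ hn => absurd hn (Nat.not_lt_zero _)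

lemma mul_mem_weightIdeal {a b j k l : ℕ} {f g : localRing} (hf : f ∈ weightIdeal a b j)
    (hg : g ∈ weightIdeal a b k) (hl : l ≤ j + k) : f * g ∈ weightIdeal a b l := by
  intro n hn
  rw [coef_mul]
  refine Finset.sum_eq_zero fun p hp => ?_
  obtain rfl := Finset.HasAntidiagonal.mem_antidiagonal.mp hp
  rw [Finsupp.add_apply, Finsupp.add_apply] at hn
  by_cases h : a * p.1 0 + b * p.1 1 < j
  · rw [hf p.1 h, zero_mul]
  · rw [hg p.2 (by nlinarith), mul_zero]

lemma xy_mem_weightIdeal {a b k i j : ℕ} (h : k ≤ a * i + b * j) :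
    x ^ i * y ^ j ∈ weightIdeal a b k := by
  intro n hn
  rw [coef_xy, if_neg]
  rintro ⟨rfl, rfl⟩
  omega

lemma mem_weightIdeal_one {a b : ℕ} (ha : 0 < a) (hb : 0 < b) {f : localRing} :
    f ∈ weightIdeal a b 1 ↔ valueAtZero f = 0 := by
  constructor
  · intro h
    exact h 0 (by simp)
  · intro h n hn
    have h0 : a * n 0 = 0 := by omega
    have h1 : b * n 1 = 0 := by omega
    have : n = 0 := exponent_ext (by simpa [ha.ne'] using h0) (by simpa [hb.ne'] using h1)
    rw [this]; exact h

lemma eq_zero_of_forall_mem_weightIdeal {a b : ℕ} {f : localRing}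
    (h : ∀ k, f ∈ weightIdeal a b k) : f = 0 :=
  localRing_ext fun n => by rw [map_zero]; exact h _ n (Nat.lt_succ_self _)

/-! ### Hensel's lemma for convergent power series -/

/-- The right-hand side of the fixed point equation `z = p + q z + z² H(z)`. -/
def quadMap (p q : localRing) (H : Polynomial localRing) (z : localRing) : localRing :=
  p + q * z + z ^ 2 * H.eval z

/-- The difference of the two images factors as `z - z'` times a germ vanishing at the origin, so
the map is a contraction for the order filtration. -/
lemma quadMap_sub_mem {p q : localRing} (hq : valueAtZero q = 0) (H : Polynomial localRing)
    {z z' : localRing} (hz : valueAtZero z = 0) (hz' : valueAtZero z' = 0) {k : ℕ}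
    (h : z - z' ∈ weightIdeal 1 1 k) :
    quadMap p q H z - quadMap p q H z' ∈ weightIdeal 1 1 (k + 1) := by
  obtain ⟨c, hc⟩ := Polynomial.sub_dvd_eval_sub z z' H
  have e : quadMap p q H z - quadMap p q H z' =
      (z - z') * (q + (z + z') * H.eval z + z' ^ 2 * c) := by
    have : H.eval z = H.eval z' + (z - z') * c := by rw [← hc]; ring
    simp only [quadMap, this]
    ring
  rw [e]
  refine mul_mem_weightIdeal h ((mem_weightIdeal_one one_pos one_pos).2 ?_) le_rfl
  simp only [← valueAtZeroHom_apply] at *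
  simp [hq, hz, hz']

/-- A germ `z` with `z(0) = 0` and `z = p + q z + z² H(z)` exists when `p(0) = q(0) = 0`. -/
theorem exists_quadMap_fixed {p q : localRing} (hp : valueAtZero p = 0) (hq : valueAtZero q = 0)
    (H : Polynomial localRing) : ∃ z : localRing, valueAtZero z = 0 ∧ quadMap p q H z = z := by
  classical
  -- constants
  have hH : ∀ i, ∃ s : ℝ≥0, 0 < s ∧ ∀ r ≤ s,
      majorant r (H.coeff i).1 ≤ majorant s (H.coeff i).1 ∧ majorant s (H.coeff i).1 ≠ ∞ :=
    fun i => exists_majorant_lt_top _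
  choose s hs hsr using hH
  set N := H.natDegree + 1 with hN
  set M : ℝ≥0∞ := ∑ i ∈ Finset.range N, majorant (s i) (H.coeff i).1 with hM
  have hMtop : M ≠ ∞ := ENNReal.sum_ne_top.2 fun i _ => (hsr i _ le_rfl).2
  lift M to ℝ≥0 using hMtop with M'
  -- The ball of radius `δ` in the majorant norm will be stable. `δ ≤ 1` lets the coefficients of
  -- `H` bound `H(z)` by `M'`, and `δ * M' ≤ 1 / 4` controls the quadratic term.
  obtain ⟨δ, hδ0, hδ1, hδM⟩ : ∃ δ : ℝ≥0, 0 < δ ∧ δ ≤ 1 ∧ δ * M' ≤ 1 / 4 := by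
    refine ⟨min 1 (1 / (4 * (M' + 1))), by positivity, min_le_left _ _, ?_⟩
    calc min 1 (1 / (4 * (M' + 1))) * M' ≤ 1 / (4 * (M' + 1)) * (M' + 1) := by
          gcongr
          · exact min_le_right _ _
          · simp
      _ = 1 / 4 := by field_simp
  obtain ⟨s1, hs1, hps⟩ := exists_majorant_le p hp (δ / 4) (by positivity)
  obtain ⟨s2, hs2, hqs⟩ := exists_majorant_le q hq (1 / 4) (by positivity)
  obtain ⟨s3, hs3, hs3le⟩ : ∃ s3 : ℝ≥0, 0 < s3 ∧ ∀ i ∈ Finset.range N, s3 ≤ s i :=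
    ⟨(Finset.range N).inf' ⟨0, by simp [hN]⟩ s,
      (Finset.lt_inf'_iff _).2 fun i _ => hs i, fun i hi => Finset.inf'_le _ hi⟩
  set r : ℝ≥0 := min s1 (min s2 s3) with hr
  have hr0 : 0 < r := lt_min hs1 (lt_min hs2 hs3)
  have hpr := hps r (min_le_left _ _)
  have hqr := hqs r ((min_le_right _ _).trans (min_le_left _ _))
  have hbound : ∀ z : localRing, majorant r z.1 ≤ δ → majorant r (quadMap p q H z).1 ≤ δ := by
    intro z hz
    have hz1 : majorant r z.1 ≤ 1 := hz.trans (by exact_mod_cast hδ1)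
    have hsum : ∀ (t : Finset ℕ) (f : ℕ → localRing),
        majorant r (∑ i ∈ t, f i).1 ≤ ∑ i ∈ t, majorant r (f i).1 := by
      intro t f
      induction t using Finset.induction_on with
      | empty => simp [majorant]
      | insert a t ha ih =>
        rw [Finset.sum_insert ha, Finset.sum_insert ha]
        exact (majorant_add_le r _ _).trans (by gcongr)
    have hHz : majorant r (H.eval z).1 ≤ M' := by
      rw [Polynomial.eval_eq_sum_range, hM]
      refine (hsum _ _).trans (Finset.sum_le_sum fun i hi => ?_)
      calc majorant r (H.coeff i * z ^ i).1
          ≤ majorant r (H.coeff i).1 * majorant r (z.1 ^ i) := majorant_mul_le r _ _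
        _ ≤ majorant (s i) (H.coeff i).1 * 1 := by
            gcongr
            · exact (hsr i r (((min_le_right _ _).trans (min_le_right _ _)).trans
                (hs3le i hi))).1
            · exact (majorant_pow_le r _ _).trans (pow_le_one' hz1 i)
        _ = _ := mul_one _
    -- Each of the three summands `p`, `q z` and `z² H(z)` is at most `δ / 4`.
    calc majorant r (quadMap p q H z).1
        ≤ majorant r (p + q * z).1 + majorant r (z ^ 2 * H.eval z).1 := majorant_add_le r _ _
      _ ≤ (majorant r p.1 + majorant r (q * z).1) + majorant r (z ^ 2).1 * majorant r (H.eval z).1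
          := add_le_add (majorant_add_le r _ _) (majorant_mul_le r _ _)
      _ ≤ ((δ / 4 : ℝ≥0) + majorant r q.1 * majorant r z.1) + majorant r z.1 ^ 2 * M' := by
          gcongr
          · exact majorant_mul_le r _ _
          · exact majorant_pow_le r _ _
      _ ≤ ((δ / 4 : ℝ≥0) + (1 / 4 : ℝ≥0) * δ) + δ ^ 2 * M' := by gcongr
      _ ≤ δ := by
          norm_cast
          calc δ / 4 + 1 / 4 * δ + δ ^ 2 * M' = δ / 4 + 1 / 4 * δ + δ * (δ * M') := by ring
            _ ≤ δ / 4 + 1 / 4 * δ + δ * (1 / 4) := by gcongr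
            _ = δ * (3 / 4) := by ring
            _ ≤ δ * 1 := by
              gcongr
              rw [div_le_one (by norm_num)]
              norm_num
            _ = δ := mul_one _
  -- the iteration
  let Z : ℕ → localRing := fun k => (quadMap p q H)^[k] 0
  have hZs : ∀ k, Z (k + 1) = quadMap p q H (Z k) := fun k =>
    Function.iterate_succ_apply' _ _ _
  have hZb : ∀ k, majorant r (Z k).1 ≤ δ := by
    intro k
    induction k with
    | zero => simp [Z, majorant]
    | succ k ih => rw [hZs]; exact hbound _ ih
  have hval : ∀ z, valueAtZero z = 0 → valueAtZero (quadMap p q H z) = 0 := by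
    intro z hz
    simp only [← valueAtZeroHom_apply] at *
    simp [quadMap, hp, hz]
  have hZ0 : ∀ k, valueAtZero (Z k) = 0 := by
    intro k
    induction k with
    | zero => exact map_zero valueAtZeroHom
    | succ k ih => rw [hZs]; exact hval _ ih
  have hstep : ∀ k, Z (k + 1) - Z k ∈ weightIdeal 1 1 k := by
    intro k
    induction k with
    | zero => rw [weightIdeal_zero]; trivial
    | succ k ih =>
      rw [hZs (k + 1)]
      nth_rewrite 2 [hZs k]
      exact quadMap_sub_mem hq H (hZ0 _) (hZ0 _) ih
  have hcauchy : ∀ k l, Z (k + l) - Z k ∈ weightIdeal 1 1 k := by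
    intro k l
    induction l with
    | zero => simp
    | succ l ih =>
      have : Z (k + (l + 1)) - Z k = (Z (k + l + 1) - Z (k + l)) + (Z (k + l) - Z k) := by
        rw [← add_assoc]; ring
      rw [this]
      exact add_mem (weightIdeal_anti (Nat.le_add_right k l) (hstep _)) ih
  have hcoef : ∀ (n : Fin 2 →₀ ℕ) (k : ℕ), n 0 + n 1 < k →
      coef n (Z k) = coef n (Z (n 0 + n 1 + 1)) := by
    intro n k hk
    obtain ⟨l, rfl⟩ := Nat.exists_eq_add_of_le (Nat.succ_le_of_lt hk)
    have := hcauchy (n 0 + n 1 + 1) l n (by omega)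
    rw [map_sub, sub_eq_zero] at this
    exact this
  -- the limit
  let ζ : MvPowerSeries (Fin 2) ℂ := fun n => coef n (Z (n 0 + n 1 + 1))
  have hζ : ∀ n, MvPowerSeries.coeff n ζ = coef n (Z (n 0 + n 1 + 1)) := fun n => rfl
  have hζb : majorant r ζ ≤ δ := by
    -- A finite partial sum of the majorant of the limit is also a partial sum for one sufficiently
    -- late iterate, so the bound `δ` passes to the limit and gives convergence.
    rw [majorant, ENNReal.tsum_eq_iSup_sum]
    refine iSup_le fun t => ?_
    have : ∀ n ∈ t, ‖MvPowerSeries.coeff n ζ‖ₑ * (r : ℝ≥0∞) ^ (n 0 + n 1) =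
        ‖MvPowerSeries.coeff n (Z (t.sup (fun n => n 0 + n 1) + 1)).1‖ₑ *
          (r : ℝ≥0∞) ^ (n 0 + n 1) := by
      intro n hn
      rw [hζ, ← coef_apply, hcoef n (t.sup (fun n => n 0 + n 1) + 1)
        (Nat.lt_succ_of_le (Finset.le_sup (f := fun n : Fin 2 →₀ ℕ => n 0 + n 1) hn))]
    rw [Finset.sum_congr rfl this]
    exact (ENNReal.sum_le_tsum t).trans (hZb _)
  let z : localRing := ⟨ζ, (isConvergent_iff ζ).2
    ⟨r, hr0, ne_top_of_le_ne_top ENNReal.coe_ne_top hζb⟩⟩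
  have hzZ : ∀ k, z - Z k ∈ weightIdeal 1 1 k := by
    intro k n hn
    rw [map_sub, sub_eq_zero, hcoef n k (by omega)]
    exact hζ n
  have hz0 : valueAtZero z = 0 := hZ0 1
  refine ⟨z, hz0, ?_⟩
  rw [← sub_eq_zero]
  refine eq_zero_of_forall_mem_weightIdeal (a := 1) (b := 1) fun k => ?_
  -- Both the limit and its image agree with `Z (k + 1)` up to order `k + 1`, for every `k`.
  have : quadMap p q H z - z =
      (quadMap p q H z - quadMap p q H (Z k)) - (z - Z (k + 1)) := by rw [hZs]; ring
  rw [this]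
  exact weightIdeal_anti (Nat.le_succ k)
    (sub_mem (quadMap_sub_mem hq H hz0 (hZ0 k) (hzZ k)) (hzZ (k + 1)))

/-- **Hensel's lemma**: simple roots of polynomials over `ℂ` lift to `ℂ{x, y}`. -/
theorem exists_root_of_simple_root (P : Polynomial localRing) (a : localRing)
    (h0 : valueAtZero (P.eval a) = 0) (h1 : valueAtZero (P.derivative.eval a) ≠ 0) :
    ∃ t, valueAtZero t = valueAtZero a ∧ P.eval t = 0 := by
  set c := valueAtZero (P.derivative.eval a) with hc
  set Q := Polynomial.taylor a P with hQ
  have hQ0 : Q.coeff 0 = P.eval a := Polynomial.taylor_coeff_zero _ _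
  have hQ1 : Q.coeff 1 = P.derivative.eval a := Polynomial.taylor_coeff_one _ _
  -- With `Q(z) = P(z + a)` and `c = P'(a)(0)`, the equation `Q(z) = 0` is rewritten as `z = z - c⁻¹
  -- Q(z)`; the linear coefficient `1 - c⁻¹ Q₁` vanishes at the origin.
  obtain ⟨z, hz, hfix⟩ := exists_quadMap_fixed
    (p := algebraMap ℂ localRing (-c⁻¹) * Q.coeff 0)
    (q := 1 - algebraMap ℂ localRing c⁻¹ * Q.coeff 1)
    (by
      simp only [← valueAtZeroHom_apply] at *
      simp [hQ0, h0])
    (by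
      simp only [← valueAtZeroHom_apply] at *
      rw [hQ1, map_sub, map_mul, ← hc, map_one, AlgHom.commutes]
      simp [h1])
    (Polynomial.C (algebraMap ℂ localRing (-c⁻¹)) * Q.divX.divX)
  refine ⟨z + a, ?_, ?_⟩
  · simp only [← valueAtZeroHom_apply] at *
    simp [hz]
  · rw [← Polynomial.taylor_eval, ← hQ]
    have e : Q.eval z = Q.coeff 0 + Q.coeff 1 * z + z ^ 2 * Q.divX.divX.eval z := by
      conv_lhs => rw [← Polynomial.divX_mul_X_add Q, ← Polynomial.divX_mul_X_add Q.divX]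
      simp only [Polynomial.eval_add, Polynomial.eval_mul, Polynomial.eval_X, Polynomial.eval_C,
        Polynomial.coeff_divX]
      ring
    have hcc : algebraMap ℂ localRing c * algebraMap ℂ localRing c⁻¹ = 1 := by
      rw [← map_mul, mul_inv_cancel₀ h1, map_one]
    simp only [quadMap, Polynomial.eval_mul, Polynomial.eval_C, map_neg, Polynomial.eval_neg] at hfix
    rw [e]
    linear_combination (-algebraMap ℂ localRing c) * hfix -
      (Q.coeff 0 + Q.coeff 1 * z + z ^ 2 * Q.divX.divX.eval z) * hcc

/-- The inverse of `f` is the Hensel root of the linear polynomial `f X - 1`. -/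
lemma isUnit_iff_valueAtZero_ne_zero {f : localRing} : IsUnit f ↔ valueAtZero f ≠ 0 := by
  constructor
  · intro h
    exact (h.map valueAtZeroHom).ne_zero
  · intro h
    set c := valueAtZero f with hc
    obtain ⟨t, -, ht⟩ := exists_root_of_simple_root
      (Polynomial.C f * Polynomial.X - 1) (algebraMap ℂ localRing c⁻¹)
      (by
        simp only [← valueAtZeroHom_apply] at *
        simp [← hc, h])
      (by
        simp only [← valueAtZeroHom_apply] at *
        simp [← hc, h])
    refine IsUnit.of_mul_eq_one t ?_
    simpa [sub_eq_zero] using ht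

/-! ### Finite generation of the weight filtration -/

lemma isConvergent_of_norm_coeff_le (d : Fin 2 →₀ ℕ) (f : localRing)
    (φ : MvPowerSeries (Fin 2) ℂ) (h : ∀ n, ‖MvPowerSeries.coeff n φ‖ ≤ ‖coef (n + d) f‖) :
    IsConvergent φ := by
  obtain ⟨r, hr, hf⟩ := f.2
  refine ⟨r, hr, ?_⟩
  have h2 := (hf.comp_injective (add_left_injective d)).mul_left ((r ^ (d 0 + d 1))⁻¹)
  refine Summable.of_nonneg_of_le (fun n => by positivity) (fun n => ?_) h2
  simp only [Function.comp_apply, Finsupp.add_apply]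
  have e : (r ^ (d 0 + d 1))⁻¹ * (‖MvPowerSeries.coeff (n + d) f.1‖ * r ^ (n 0 + d 0 + (n 1 + d 1)))
      = ‖MvPowerSeries.coeff (n + d) f.1‖ * r ^ (n 0 + n 1) := by
    have : n 0 + d 0 + (n 1 + d 1) = (n 0 + n 1) + (d 0 + d 1) := by ring
    rw [this, pow_add r (n 0 + n 1), mul_comm (r ^ (n 0 + n 1)), mul_left_comm, ← mul_assoc ((r ^ (d 0 + d 1))⁻¹),
      inv_mul_cancel₀ (pow_pos hr _).ne', one_mul]
  rw [e]
  gcongr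
  exact h n

/-- The quotient of the part of `f` divisible by `x ^ i * y ^ j` by that monomial. -/
def divMonomial (i j : ℕ) (f : localRing) : localRing :=
  ⟨fun n => coef (n + expo i j) f, isConvergent_of_norm_coeff_le (expo i j) f _ fun _ => le_rfl⟩

lemma coef_divMonomial (i j : ℕ) (f : localRing) (n : Fin 2 →₀ ℕ) :
    coef n (divMonomial i j f) = coef (n + expo i j) f := rfl

open Classical in
/-- The part of `f` supported on exponents satisfying `P`. -/
def restrictSupport (P : (Fin 2 →₀ ℕ) → Prop) (f : localRing) : localRing :=
  ⟨fun n => if P n then coef n f else 0, isConvergent_of_norm_coeff_le 0 f _ fun n => by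
    change ‖if P n then coef n f else 0‖ ≤ _
    split_ifs <;> simp⟩

open Classical in
lemma coef_restrictSupport (P : (Fin 2 →₀ ℕ) → Prop) (f : localRing) (n : Fin 2 →₀ ℕ) :
    coef n (restrictSupport P f) = if P n then coef n f else 0 := rfl

/-- The terms divisible by `x` go into `α x`; the remaining terms are pure powers of `y` and go into
`β y`. No constant term is left since `k > 0`. -/
lemma exists_eq_mul_x_add_mul_y {a b k : ℕ} (hk : 0 < k) {f : localRing}
    (hf : f ∈ weightIdeal a b k) :
    ∃ α ∈ weightIdeal a b (k - a), ∃ β ∈ weightIdeal a b (k - b), f = α * x + β * y := by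
  classical
  refine ⟨divMonomial 1 0 f, fun n hn => ?_,
    restrictSupport (fun n => n 0 = 0) (divMonomial 0 1 f), fun n hn => ?_, ?_⟩
  · rw [coef_divMonomial]
    apply hf
    simp only [Finsupp.add_apply, expo_zero, expo_one, mul_add]
    omega
  · rw [coef_restrictSupport, coef_divMonomial]
    split_ifs with h
    · apply hf
      simp only [Finsupp.add_apply, expo_zero, expo_one, mul_add]
      omega
    · rfl
  · refine localRing_ext fun n => ?_
    have hx : ∀ g : localRing, g * x = g * (x ^ 1 * y ^ 0) := fun g => by simp
    have hy : ∀ g : localRing, g * y = g * (x ^ 0 * y ^ 1) := fun g => by simp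
    rw [map_add, hx, hy, coef_mul_xy, coef_mul_xy, coef_divMonomial, coef_restrictSupport, coef_divMonomial]
    by_cases h0 : n 0 = 0
    · by_cases h1 : n 1 = 0
      · have : n = 0 := exponent_ext (by simpa using h0) (by simpa using h1)
        subst this
        simp [hf 0 (by simpa using hk)]
      · have h1' : 1 ≤ n 1 := Nat.one_le_iff_ne_zero.2 h1
        have e : expo (n 0 - 0) (n 1 - 1) + expo 0 1 = n :=
          exponent_ext (by simp) (by simp [h1'])
        rw [e]
        simp [h0, h1']
    · have h0' : 1 ≤ n 0 := Nat.one_le_iff_ne_zero.2 h0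
      have e : expo (n 0 - 1) (n 1 - 0) + expo 1 0 = n :=
        exponent_ext (by simp [h0']) (by simp)
      rw [e]
      simp [h0, h0']

lemma weightIdeal_le_span {a b : ℕ} (ha : 0 < a) (hb : 0 < b) (k : ℕ) :
    weightIdeal a b k ≤
      Ideal.span {f | ∃ i j, k ≤ a * i + b * j ∧ f = x ^ i * y ^ j} := by
  induction k using Nat.strong_induction_on with
  | _ k ih =>
    intro f hf
    rcases Nat.eq_zero_or_pos k with rfl | hk
    · have : (1 : localRing) ∈
          Ideal.span {f | ∃ i j, 0 ≤ a * i + b * j ∧ f = x ^ i * y ^ j} :=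
        Ideal.subset_span ⟨0, 0, Nat.zero_le _, by simp⟩
      rw [(Ideal.eq_top_iff_one _).2 this]
      trivial
    · obtain ⟨α, hα, β, hβ, rfl⟩ := exists_eq_mul_x_add_mul_y hk hf
      have aux : ∀ (g z : localRing) (c : ℕ),
          g ∈ Ideal.span {f | ∃ i j, k - c ≤ a * i + b * j ∧ f = x ^ i * y ^ j} →
          (∀ i j, k - c ≤ a * i + b * j → ∃ i' j', k ≤ a * i' + b * j' ∧
            x ^ i * y ^ j * z = x ^ i' * y ^ j') →
          g * z ∈ Ideal.span {f | ∃ i j, k ≤ a * i + b * j ∧ f = x ^ i * y ^ j} := by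
        intro g z c hg hz
        induction hg using Submodule.span_induction with
        | mem g hg =>
          obtain ⟨i, j, hij, rfl⟩ := hg
          obtain ⟨i', j', h', e⟩ := hz i j hij
          rw [e]
          exact Ideal.subset_span ⟨i', j', h', rfl⟩
        | zero => rw [zero_mul]; exact zero_mem _
        | add g h _ _ hg hh => rw [add_mul]; exact add_mem hg hh
        | smul c g _ hg => rw [smul_mul_assoc]; exact Submodule.smul_mem _ _ hg
      refine add_mem (aux α x a (ih (k - a) (by omega) hα) fun i j hij => ?_)
        (aux β y b (ih (k - b) (by omega) hβ) fun i j hij => ?_)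
      · exact ⟨i + 1, j, by rw [mul_add]; omega, by ring⟩
      · exact ⟨i, j + 1, by rw [mul_add]; omega, by ring⟩

/-- Finite generation is what Nakayama's lemma requires. It follows recursively from splitting off a
factor `x` or `y`. -/
lemma weightIdeal_fg {a b : ℕ} (ha : 0 < a) (hb : 0 < b) (k : ℕ) : (weightIdeal a b k).FG := by
  induction k using Nat.strong_induction_on with
  | _ k ih =>
    rcases Nat.eq_zero_or_pos k with rfl | hk
    · rw [weightIdeal_zero]
      exact ⟨{1}, by simp⟩
    · have : weightIdeal a b k =
          weightIdeal a b (k - a) * Ideal.span {x} ⊔ weightIdeal a b (k - b) * Ideal.span {y} := by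
        refine le_antisymm (fun f hf => ?_) (sup_le ?_ ?_)
        · obtain ⟨α, hα, β, hβ, rfl⟩ := exists_eq_mul_x_add_mul_y hk hf
          exact Submodule.add_mem_sup
            (Ideal.mul_mem_mul hα (Ideal.mem_span_singleton_self x))
            (Ideal.mul_mem_mul hβ (Ideal.mem_span_singleton_self y))
        · refine Ideal.mul_le.2 fun g hg z hz => ?_
          obtain ⟨c, rfl⟩ := Ideal.mem_span_singleton'.1 hz
          refine mul_mem_weightIdeal hg (Ideal.mul_mem_left _ c ?_) (l := k) (k := a) (by omega)
          simpa using xy_mem_weightIdeal (a := a) (b := b) (k := a) (i := 1) (j := 0) (by simp)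
        · refine Ideal.mul_le.2 fun g hg z hz => ?_
          obtain ⟨c, rfl⟩ := Ideal.mem_span_singleton'.1 hz
          refine mul_mem_weightIdeal hg (Ideal.mul_mem_left _ c ?_) (l := k) (k := b) (by omega)
          simpa using xy_mem_weightIdeal (a := a) (b := b) (k := b) (i := 0) (j := 1) (by simp)
      rw [this]
      exact Submodule.FG.sup (Ideal.FG.mul (ih _ (by omega)) (Submodule.fg_span_singleton x))
        (Ideal.FG.mul (ih _ (by omega)) (Submodule.fg_span_singleton y))

lemma weightIdeal_one_le_jacobson {a b : ℕ} (ha : 0 < a) (hb : 0 < b) :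
    weightIdeal a b 1 ≤ (⊥ : Ideal localRing).jacobson := by
  intro f hf
  rw [mem_weightIdeal_one ha hb] at hf
  rw [Ideal.mem_jacobson_bot]
  intro g
  rw [isUnit_iff_valueAtZero_ne_zero]
  simp only [← valueAtZeroHom_apply] at *
  simp [hf]

/-! ### Division by a semi-quasihomogeneous pair -/

section Division

variable {a b p q : ℕ} {u v : localRing}

/-- Replacing a factor `x^p` by `x^p - u`, or `y^q` by `y^q - v`, changes the monomial by an element
of `(u, v)` and strictly raises its weight. -/
lemma xy_mem_sup_of_le (hu : u - x ^ p ∈ weightIdeal a b (a * p + 1))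
    (hv : v - y ^ q ∈ weightIdeal a b (b * q + 1)) {k i j : ℕ} (hk : k ≤ a * i + b * j)
    (h : p ≤ i ∨ q ≤ j) :
    x ^ i * y ^ j ∈ Ideal.span {u, v} ⊔ weightIdeal a b (k + 1) := by
  rcases h with h | h
  · obtain ⟨l, rfl⟩ := Nat.exists_eq_add_of_le h
    have e : x ^ (p + l) * y ^ j = x ^ l * y ^ j * u + -(x ^ l * y ^ j * (u - x ^ p)) := by ring
    rw [e]
    refine Submodule.add_mem_sup
      (Ideal.mul_mem_left _ _ (Ideal.subset_span (Set.mem_insert _ _)))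
      (neg_mem (mul_mem_weightIdeal (xy_mem_weightIdeal le_rfl) hu ?_))
    rw [mul_add] at hk; omega
  · obtain ⟨l, rfl⟩ := Nat.exists_eq_add_of_le h
    have e : x ^ i * y ^ (q + l) = x ^ i * y ^ l * v + -(x ^ i * y ^ l * (v - y ^ q)) := by ring
    rw [e]
    refine Submodule.add_mem_sup
      (Ideal.mul_mem_left _ _ (Ideal.subset_span (Set.mem_insert_of_mem _ rfl)))
      (neg_mem (mul_mem_weightIdeal (xy_mem_weightIdeal le_rfl) hv ?_))
    rw [mul_add] at hk; omega

/-- A monomial of weight at least `ap + bq` is divisible by `x^p` or `y^q`, so it can be pushed to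
any higher weight modulo `(u, v)`. Nakayama's lemma turns this into actual membership. -/
lemma weightIdeal_le_span_pair (ha : 0 < a) (hb : 0 < b)
    (hu : u - x ^ p ∈ weightIdeal a b (a * p + 1))
    (hv : v - y ^ q ∈ weightIdeal a b (b * q + 1)) :
    weightIdeal a b (a * p + b * q) ≤ Ideal.span {u, v} := by
  have step : ∀ k, a * p + b * q ≤ k →
      weightIdeal a b k ≤ Ideal.span {u, v} ⊔ weightIdeal a b (k + 1) := by
    intro k hk
    refine (weightIdeal_le_span ha hb k).trans (Ideal.span_le.2 ?_)
    rintro _ ⟨i, j, hij, rfl⟩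
    refine xy_mem_sup_of_le hu hv hij ?_
    by_contra! h
    have h1 : a * i < a * p := Nat.mul_lt_mul_of_pos_left h.1 ha
    have h2 : b * j < b * q := Nat.mul_lt_mul_of_pos_left h.2 hb
    omega
  have steps : ∀ l, weightIdeal a b (a * p + b * q) ≤
      Ideal.span {u, v} ⊔ weightIdeal a b (a * p + b * q + l) := by
    intro l
    induction l with
    | zero => exact le_sup_right
    | succ l ih =>
      exact ih.trans (sup_le le_sup_left (step _ (Nat.le_add_right _ l)))
  refine Submodule.le_of_le_smul_of_le_jacobson_bot (weightIdeal_fg ha hb _)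
    (weightIdeal_one_le_jacobson ha hb) ((steps (a + b)).trans (sup_le_sup_left ?_ _))
  -- The excess weight `a + b` leaves the cofactors of `x` and `y` in the original weight ideal
  -- after one variable is split off.
  intro f hf
  obtain ⟨α, hα, β, hβ, rfl⟩ := exists_eq_mul_x_add_mul_y (by omega) hf
  rw [smul_eq_mul, mul_comm α, mul_comm β]
  exact add_mem
    (Ideal.mul_mem_mul ((mem_weightIdeal_one ha hb).2 valueAtZero_x)
      (weightIdeal_anti (by omega) hα))
    (Ideal.mul_mem_mul ((mem_weightIdeal_one ha hb).2 valueAtZero_y)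
      (weightIdeal_anti (by omega) hβ))

/-- The linear span of the monomials `x ^ i * y ^ j` with `(i, j) ∈ S`. -/
def monomialSpan (S : Set (ℕ × ℕ)) : Submodule ℂ localRing :=
  Submodule.span ℂ ((fun s : ℕ × ℕ => x ^ s.1 * y ^ s.2) '' S)

lemma xy_mem_monomialSpan {S : Set (ℕ × ℕ)} {i j : ℕ} (h : (i, j) ∈ S) :
    x ^ i * y ^ j ∈ monomialSpan S := Submodule.subset_span ⟨(i, j), h, rfl⟩

lemma coef_eq_zero_of_mem_monomialSpan {S : Set (ℕ × ℕ)} {f : localRing}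
    (hf : f ∈ monomialSpan S) {n : Fin 2 →₀ ℕ} (hn : (n 0, n 1) ∉ S) : coef n f = 0 := by
  induction hf using Submodule.span_induction with
  | mem g hg =>
    obtain ⟨s, hs, rfl⟩ := hg
    rw [coef_xy, if_neg]
    rintro ⟨h0, h1⟩
    exact hn (by rw [h0, h1]; exact hs)
  | zero => exact map_zero _
  | add g h _ _ hg hh => rw [map_add, hg, hh, add_zero]
  | smul c g _ hg => rw [map_smul, hg, smul_zero]

/-- The rectangle of exponents below `x ^ p` and `y ^ q`. -/
def rect (p q : ℕ) : Set (ℕ × ℕ) := {s | s.1 < p ∧ s.2 < q}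

/-- Descending induction on weight: at high weight everything lies in `(u, v)`, and one step down
only monomials of the rectangle are new modulo `(u, v)` and higher weight. -/
theorem monomialSpan_rect_sup_span_pair (ha : 0 < a) (hb : 0 < b)
    (hu : u - x ^ p ∈ weightIdeal a b (a * p + 1))
    (hv : v - y ^ q ∈ weightIdeal a b (b * q + 1)) (f : localRing) :
    ∃ r ∈ monomialSpan (rect p q), f - r ∈ Ideal.span {u, v} := by
  set J := Ideal.span {u, v} with hJ
  set T : Submodule ℂ localRing := monomialSpan (rect p q) ⊔ J.restrictScalars ℂ with hT
  suffices h : ∀ l k, a * p + b * q ≤ k + l → ∀ g ∈ weightIdeal a b k, g ∈ T by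
    have := h (a * p + b * q) 0 (by simp) f (by rw [weightIdeal_zero]; trivial)
    obtain ⟨r, hr, j, hj, e⟩ := Submodule.mem_sup.1 this
    exact ⟨r, hr, by rw [← e, add_sub_cancel_left]; exact hj⟩
  intro l
  induction l with
  | zero =>
    intro k hk g hg
    exact (le_sup_right : _ ≤ T)
      (weightIdeal_le_span_pair ha hb hu hv (weightIdeal_anti hk hg))
  | succ l ih =>
    intro k hk g hg
    have hnext := ih (k + 1) (by omega)
    have hmono : ∀ i j, k ≤ a * i + b * j → x ^ i * y ^ j ∈ T := by
      intro i j hij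
      by_cases h : i < p ∧ j < q
      · exact (le_sup_left : _ ≤ T) (xy_mem_monomialSpan h)
      · obtain ⟨c, hc, d, hd, e⟩ := Submodule.mem_sup.1
          (xy_mem_sup_of_le hu hv hij (by omega))
        rw [← e]
        exact add_mem ((le_sup_right : _ ≤ T) hc) (hnext d hd)
    have hg' := weightIdeal_le_span ha hb k hg
    -- `T` is only a complex subspace, so the induction also carries the weight bound: a coefficient
    -- `c` splits as its value at the origin plus a germ that raises the weight of `g`.
    suffices h : g ∈ T ∧ g ∈ weightIdeal a b k from h.1
    clear hg
    induction hg' using Submodule.span_induction with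
    | mem g hg =>
      obtain ⟨i, j, hij, rfl⟩ := hg
      exact ⟨hmono i j hij, xy_mem_weightIdeal hij⟩
    | zero => exact ⟨zero_mem _, zero_mem _⟩
    | add g h _ _ hg hh => exact ⟨add_mem hg.1 hh.1, add_mem hg.2 hh.2⟩
    | smul c g _ hg =>
      refine ⟨?_, Ideal.mul_mem_left _ c hg.2⟩
      have e : c • g = valueAtZero c • g +
          (c - algebraMap ℂ localRing (valueAtZero c)) * g := by
        rw [Algebra.smul_def (valueAtZero c) g, smul_eq_mul]; ring
      rw [e]
      refine add_mem (Submodule.smul_mem _ _ hg.1) (hnext _ ?_)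
      refine mul_mem_weightIdeal ((mem_weightIdeal_one ha hb).2 ?_) hg.2 (by omega)
      simp only [← valueAtZeroHom_apply]
      simp

end Division

/-! ### Independence of the rectangle monomials modulo the pair -/

section Independence

variable {a b p q : ℕ} {u v : localRing}

lemma coef_mul_x_pow (n : Fin 2 →₀ ℕ) (f : localRing) (i : ℕ) :
    coef n (f * x ^ i) = if i ≤ n 0 then coef (expo (n 0 - i) (n 1)) f else 0 := by
  have := coef_mul_xy n f i 0
  simpa using this

lemma coef_mul_y_pow (n : Fin 2 →₀ ℕ) (f : localRing) (j : ℕ) :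
    coef n (f * y ^ j) = if j ≤ n 1 then coef (expo (n 0) (n 1 - j)) f else 0 := by
  have := coef_mul_xy n f 0 j
  simpa using this

/-- In lowest weight, `f = Qu + Rv` reads `Q x^p + R y^q`, all of whose monomials lie outside the
rectangle, so this lowest part cancels. The lowest part of `Q` is thus divisible by `y^q`, and a
Koszul syzygy removes it together with that of `R`. Iterating places `f` in every weight ideal. -/
theorem eq_zero_of_mem_span_pair
    (hu : u - x ^ p ∈ weightIdeal a b (a * p + 1))
    (hv : v - y ^ q ∈ weightIdeal a b (b * q + 1)) {f : localRing}
    (hf : ∀ n : Fin 2 →₀ ℕ, (n 0, n 1) ∉ rect p q → coef n f = 0)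
    (hmem : f ∈ Ideal.span {u, v}) : f = 0 := by
  have key : ∀ k, ∃ Q R, f = Q * u + R * v ∧ Q ∈ weightIdeal a b (k - a * p) ∧
      R ∈ weightIdeal a b (k - b * q) := by
    intro k
    induction k with
    | zero =>
      obtain ⟨Q, R, h⟩ := Ideal.mem_span_pair.1 hmem
      exact ⟨Q, R, h.symm, by simp [weightIdeal_zero], by simp [weightIdeal_zero]⟩
    | succ k ih =>
      obtain ⟨Q, R, e, hQ, hR⟩ := ih
      have lead : ∀ n : Fin 2 →₀ ℕ, a * n 0 + b * n 1 ≤ k →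
          coef n f = coef n (Q * x ^ p) + coef n (R * y ^ q) := by
        intro n hn
        have e' : f = Q * x ^ p + R * y ^ q + (Q * (u - x ^ p) + R * (v - y ^ q)) := by
          rw [e]; ring
        have h1 : Q * (u - x ^ p) + R * (v - y ^ q) ∈ weightIdeal a b (k + 1) :=
          add_mem (mul_mem_weightIdeal hQ hu (by omega)) (mul_mem_weightIdeal hR hv (by omega))
        rw [e', map_add, map_add, h1 n (by omega), add_zero]
      set c := divMonomial 0 q Q with hc
      have hcmem : c ∈ weightIdeal a b (k - a * p - b * q) := by
        intro n hn
        rw [hc, coef_divMonomial]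
        apply hQ
        simp only [Finsupp.add_apply, expo_zero, expo_one, mul_add]
        omega
      -- The representation is altered by the syzygy `(-c v, c u)`, where `c` is the quotient of `Q`
      -- by `y^q`.
      refine ⟨Q - c * v, R + c * u, by rw [e]; ring, fun n hn => ?_, fun n hn => ?_⟩
      · have h1 : coef n (c * (v - y ^ q)) = 0 :=
          mul_mem_weightIdeal hcmem hv (l := k - a * p + 1) (by omega) n (by omega)
        have e1 : Q - c * v = Q - c * y ^ q - c * (v - y ^ q) := by ring
        rw [e1, map_sub, map_sub, h1, sub_zero, coef_mul_y_pow]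
        split_ifs with hq
        · rw [hc, coef_divMonomial, sub_eq_zero]
          congr 1
          congr 1
          exact exponent_ext (by simp) (by simp [hq])
        -- Here `n 1 < q`, so at the exponent shifted by `x^p` only `Q x^p` contributes, while `f`
        -- has no such monomial.
        · have h2 := lead (n + expo p 0) (by
            simp only [Finsupp.add_apply, expo_zero, expo_one, mul_add]
            omega)
          rw [hf _ (by simp [rect]), coef_mul_x_pow, coef_mul_y_pow,
            if_pos (by simp), if_neg (by simpa using hq), add_zero] at h2
          have e2 : expo ((n + expo p 0) 0 - p) ((n + expo p 0) 1) = n :=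
            exponent_ext (by simp) (by simp)
          rw [e2] at h2
          rw [← h2, sub_zero]
      · have h1 : coef n (c * (u - x ^ p)) = 0 :=
          mul_mem_weightIdeal hcmem hu (l := k - b * q + 1) (by omega) n (by omega)
        have e1 : R + c * u = R + c * x ^ p + c * (u - x ^ p) := by ring
        rw [e1, map_add, map_add, h1, add_zero, coef_mul_x_pow]
        have h2 := lead (n + expo 0 q) (by
          simp only [Finsupp.add_apply, expo_zero, expo_one, mul_add]
          omega)
        have e2 : expo ((n + expo 0 q) 0) ((n + expo 0 q) 1 - q) = n :=
          exponent_ext (by simp) (by simp)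
        rw [hf _ (by simp [rect]), coef_mul_x_pow, coef_mul_y_pow,
            if_pos (show q ≤ (n + expo 0 q) 1 by simp), e2] at h2
        refine (add_comm _ _).trans (Eq.trans ?_ h2.symm)
        congr 1
        have e3 : (n + expo 0 q) 0 = n 0 := by simp
        rw [e3]
        refine if_congr Iff.rfl ?_ rfl
        rw [hc, coef_divMonomial]
        congr 1
        congr 1
        exact exponent_ext (by simp) (by simp)
  refine eq_zero_of_forall_mem_weightIdeal (a := a) (b := b) fun k => ?_
  obtain ⟨Q, R, rfl, hQ, hR⟩ := key k
  have hu' : u ∈ weightIdeal a b (a * p) := by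
    have := add_mem (weightIdeal_anti (Nat.le_succ _) hu)
      (xy_mem_weightIdeal (a := a) (b := b) (k := a * p) (i := p) (j := 0) (by simp))
    simpa using this
  have hv' : v ∈ weightIdeal a b (b * q) := by
    have := add_mem (weightIdeal_anti (Nat.le_succ _) hv)
      (xy_mem_weightIdeal (a := a) (b := b) (k := b * q) (i := 0) (j := q) (by simp))
    simpa using this
  exact add_mem (mul_mem_weightIdeal hQ hu' (by omega)) (mul_mem_weightIdeal hR hv' (by omega))

end Independence

/-! ### Dimensions of quotients -/

/-- If the monomials with exponents in `S` form a linear basis modulo `T`, then `𝒪 / T` has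
dimension `#S`. -/
theorem finrank_quotient_of_monomial_basis (S : Finset (ℕ × ℕ)) (T : Ideal localRing)
    (hspan : ∀ f : localRing, ∃ r ∈ monomialSpan (S : Set (ℕ × ℕ)), f - r ∈ T)
    (hind : ∀ r ∈ monomialSpan (S : Set (ℕ × ℕ)), r ∈ T → r = 0) :
    FiniteDimensional ℂ (localRing ⧸ T) ∧ Module.finrank ℂ (localRing ⧸ T) = S.card := by
  set e : S → localRing := fun s => x ^ s.1.1 * y ^ s.1.2 with he
  let L : (S → ℂ) →ₗ[ℂ] localRing := Fintype.linearCombination ℂ e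
  have hrange : LinearMap.range L = monomialSpan (S : Set (ℕ × ℕ)) := by
    rw [Fintype.range_linearCombination, monomialSpan]
    congr 1
    ext f
    simp [he]
  have hL : ∀ (c : S → ℂ) (s : S), coef (expo s.1.1 s.1.2) (L c) = c s := by
    classical
    intro c s
    simp only [L, Fintype.linearCombination_apply, map_sum, map_smul, he, coef_xy, expo_zero,
      expo_one]
    rw [Finset.sum_eq_single s]
    · simp
    · intro t _ hts
      rw [if_neg, smul_zero]
      rintro ⟨h0, h1⟩
      exact hts (Subtype.ext (Prod.ext h0.symm h1.symm))
    · simp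
  let Φ : (S → ℂ) →ₗ[ℂ] (localRing ⧸ T) := (Ideal.Quotient.mkₐ ℂ T).toLinearMap ∘ₗ L
  have hΦ : ∀ c, Φ c = Ideal.Quotient.mk T (L c) := fun _ => rfl
  have hinj : Function.Injective Φ := by
    rw [injective_iff_map_eq_zero]
    intro c hc
    rw [hΦ, Ideal.Quotient.eq_zero_iff_mem] at hc
    have h0 := hind (L c) (hrange ▸ LinearMap.mem_range_self L c) hc
    funext s
    rw [← hL c s, h0, map_zero, Pi.zero_apply]
  have hsurj : Function.Surjective Φ := by
    intro z
    obtain ⟨f, rfl⟩ := Ideal.Quotient.mk_surjective z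
    obtain ⟨r, hr, hfr⟩ := hspan f
    rw [← hrange] at hr
    obtain ⟨c, rfl⟩ := hr
    exact ⟨c, ((Ideal.Quotient.mk_eq_mk_iff_sub_mem _ _).2 hfr).symm⟩
  let E := LinearEquiv.ofBijective Φ ⟨hinj, hsurj⟩
  exact ⟨Module.Finite.equiv E, by rw [← E.finrank_eq]; simp⟩

/-! ### Dimensions for a pair of corner germs and an added monomial -/

section Pair

variable {a b p q : ℕ} {u v : localRing}

lemma coe_range_product (p q : ℕ) :
    ((Finset.range p ×ˢ Finset.range q : Finset (ℕ × ℕ)) : Set (ℕ × ℕ)) = rect p q := by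
  ext s; simp [rect]

theorem finrank_quotient_span_pair (ha : 0 < a) (hb : 0 < b)
    (hu : u - x ^ p ∈ weightIdeal a b (a * p + 1))
    (hv : v - y ^ q ∈ weightIdeal a b (b * q + 1)) :
    FiniteDimensional ℂ (localRing ⧸ Ideal.span {u, v}) ∧
      Module.finrank ℂ (localRing ⧸ Ideal.span {u, v}) = p * q := by
  have := finrank_quotient_of_monomial_basis (Finset.range p ×ˢ Finset.range q)
    (Ideal.span {u, v})
    (by rw [coe_range_product]; exact monomialSpan_rect_sup_span_pair ha hb hu hv)
    (by
      rw [coe_range_product]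
      exact fun r hr hmem => eq_zero_of_mem_span_pair hu hv
        (fun n hn => coef_eq_zero_of_mem_monomialSpan hr hn) hmem)
  simpa using this

/-- Adding the monomial `w = x ^ s * y ^ t` to the ideal `⟨u, v⟩` with corner monomials
`x ^ p`, `y ^ q`, when the corner monomials of the annihilator of `w` are
`x ^ (p - s)` and `y ^ (q - t)`. -/
theorem finrank_quotient_span_monomial_sup {s t : ℕ} {u' v' : localRing}
    (ha : 0 < a) (hb : 0 < b) (hs : s ≤ p) (ht : t ≤ q)
    (hu : u - x ^ p ∈ weightIdeal a b (a * p + 1))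
    (hv : v - y ^ q ∈ weightIdeal a b (b * q + 1))
    (hu' : u' - x ^ (p - s) ∈ weightIdeal a b (a * (p - s) + 1))
    (hv' : v' - y ^ (q - t) ∈ weightIdeal a b (b * (q - t) + 1))
    (hwu : x ^ s * y ^ t * u' ∈ Ideal.span {u, v})
    (hwv : x ^ s * y ^ t * v' ∈ Ideal.span {u, v}) :
    FiniteDimensional ℂ (localRing ⧸ (Ideal.span {x ^ s * y ^ t} ⊔ Ideal.span {u, v})) ∧
      Module.finrank ℂ (localRing ⧸ (Ideal.span {x ^ s * y ^ t} ⊔ Ideal.span {u, v})) +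
        (p - s) * (q - t) = p * q := by
  classical
  set w := x ^ s * y ^ t with hw
  set J := Ideal.span {u, v} with hJ
  -- The staircase left when the monomials divisible by `w` are removed from the rectangle.
  set B : Finset (ℕ × ℕ) :=
    ((Finset.range p ×ˢ Finset.range q) \ (Finset.Ico s p ×ˢ Finset.Ico t q)) with hB
  have hBmem : ∀ i j, (i, j) ∈ (B : Set (ℕ × ℕ)) ↔ (i < p ∧ j < q) ∧ ¬ (s ≤ i ∧ t ≤ j) := by
    intro i j
    simp only [hB, Finset.coe_sdiff, Set.mem_sdiff, Finset.mem_coe, Finset.mem_product,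
      Finset.mem_range, Finset.mem_Ico]
    omega
  have hcard : B.card + (p - s) * (q - t) = p * q := by
    have hsub : (Finset.Ico s p ×ˢ Finset.Ico t q : Finset (ℕ × ℕ)) ⊆
        Finset.range p ×ˢ Finset.range q := by
      refine Finset.product_subset_product ?_ ?_ <;> intro i hi <;> simp at hi ⊢ <;> omega
    have := Finset.card_sdiff_add_card_eq_card hsub
    simpa using this
  have main := finrank_quotient_of_monomial_basis B (Ideal.span {w} ⊔ J) ?_ ?_
  · exact ⟨main.1, by rw [main.2, hcard]⟩
  · intro f
    obtain ⟨r, hr, hfr⟩ := monomialSpan_rect_sup_span_pair ha hb hu hv f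
    suffices h : ∃ r' ∈ monomialSpan (B : Set (ℕ × ℕ)), r - r' ∈ Ideal.span {w} ⊔ J by
      obtain ⟨r', hr', h⟩ := h
      refine ⟨r', hr', ?_⟩
      have e : f - r' = (f - r) + (r - r') := by ring
      rw [e]
      exact add_mem ((le_sup_right : J ≤ _) hfr) h
    clear hfr
    induction hr using Submodule.span_induction with
    | mem g hg =>
      obtain ⟨⟨i, j⟩, hij, rfl⟩ := hg
      by_cases h : s ≤ i ∧ t ≤ j
      · refine ⟨0, zero_mem _, ?_⟩
        obtain ⟨c, rfl⟩ := Nat.exists_eq_add_of_le h.1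
        obtain ⟨d, rfl⟩ := Nat.exists_eq_add_of_le h.2
        refine (le_sup_left : Ideal.span {w} ≤ _) (Ideal.mem_span_singleton'.2
          ⟨x ^ c * y ^ d, ?_⟩)
        simp only [hw, pow_add, sub_zero]
        ring
      · refine ⟨x ^ i * y ^ j, xy_mem_monomialSpan ((hBmem i j).2 ⟨hij, h⟩), ?_⟩
        simp
    | zero => exact ⟨0, zero_mem _, by simp⟩
    | add g h _ _ hg hh =>
      obtain ⟨g', hg', hg⟩ := hg
      obtain ⟨h', hh', hh⟩ := hh
      exact ⟨g' + h', add_mem hg' hh', by rw [add_sub_add_comm]; exact add_mem hg hh⟩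
    | smul c g _ hg =>
      obtain ⟨g', hg', hg⟩ := hg
      refine ⟨c • g', Submodule.smul_mem _ _ hg', ?_⟩
      rw [← smul_sub, Algebra.smul_def]
      exact Ideal.mul_mem_left _ _ hg
  · intro r hr hmem
    obtain ⟨g, hg, j, hj, e⟩ := Submodule.mem_sup.1 hmem
    obtain ⟨h, rfl⟩ := Ideal.mem_span_singleton'.1 hg
    -- Reducing the cofactor of `w` modulo `(u', v')`, which `w` multiplies into `J`, confines it to
    -- the rectangle below `x^(p-s)` and `y^(q-t)`.
    obtain ⟨h', hh', hd⟩ := monomialSpan_rect_sup_span_pair ha hb hu' hv' h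
    have hwd : w * (h - h') ∈ J := by
      obtain ⟨c, d, hcd⟩ := Ideal.mem_span_pair.1 hd
      have e' : w * (h - h') = c * (w * u') + d * (w * v') := by rw [← hcd]; ring
      rw [e']
      exact add_mem (Ideal.mul_mem_left _ _ hwu) (Ideal.mul_mem_left _ _ hwv)
    have hdiff : r - h' * w ∈ J := by
      have e' : r - h' * w = w * (h - h') + j := by rw [← e]; ring
      rw [e']
      exact add_mem hwd hj
    have hwcoef : ∀ n : Fin 2 →₀ ℕ, ((n 0, n 1) ∉ rect p q ∨ (n 0, n 1) ∈ (B : Set (ℕ × ℕ))) →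
        coef n (h' * w) = 0 := by
      intro n hn
      rw [hw, coef_mul_xy]
      split_ifs with hst
      · refine coef_eq_zero_of_mem_monomialSpan hh' ?_
        rw [hBmem] at hn
        simp only [rect, Set.mem_ofPred_eq, expo_zero, expo_one] at hn ⊢
        omega
      · rfl
    have hrcoef : ∀ n : Fin 2 →₀ ℕ, (n 0, n 1) ∉ (B : Set (ℕ × ℕ)) → coef n r = 0 :=
      fun n hn => coef_eq_zero_of_mem_monomialSpan hr hn
    -- Both `r` and `h' * w` are supported in the large rectangle, so independence modulo `J` makes
    -- them equal. Their supports are disjoint, which then forces `r = 0`.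
    have hzero : r - h' * w = 0 := eq_zero_of_mem_span_pair hu hv (fun n hn => by
      rw [map_sub, hwcoef n (Or.inl hn), hrcoef n (fun hB => hn ((hBmem _ _).1 hB).1), sub_zero])
      hdiff
    refine localRing_ext fun n => ?_
    rw [map_zero]
    by_cases hn : (n 0, n 1) ∈ (B : Set (ℕ × ℕ))
    · rw [sub_eq_zero.1 hzero, hwcoef n (Or.inr hn)]
    · exact hrcoef n hn

end Pair

/-! ### Partial derivatives -/

/-- The partial derivative as a derivation of `ℂ{x, y}`. -/
def partialDerivation (i : Fin 2) : Derivation ℂ localRing localRing :=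
  Derivation.mk'
    { toFun := partialDeriv i
      map_add' := fun f g => Subtype.ext (map_add (MvPowerSeries.pderiv ℂ i) f.1 g.1)
      map_smul' := fun c f => Subtype.ext ((MvPowerSeries.pderiv ℂ i).map_smul c f.1) }
    fun f g => Subtype.ext ((MvPowerSeries.pderiv ℂ i).leibniz f.1 g.1)

lemma partialDerivation_apply (i : Fin 2) (f : localRing) :
    partialDerivation i f = partialDeriv i f := rfl

lemma coef_partialDeriv (i : Fin 2) (f : localRing) (n : Fin 2 →₀ ℕ) :
    coef n (partialDeriv i f) = coef (n + Finsupp.single i 1) f * (n i + 1) :=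
  MvPowerSeries.coeff_pderiv _ _

lemma partialDeriv_zero_xy (i j : ℕ) :
    partialDeriv 0 (x ^ i * y ^ j) = i * (x ^ (i - 1) * y ^ j) := by
  refine localRing_ext fun n => ?_
  rw [coef_partialDeriv, ← nsmul_eq_mul, map_nsmul, coef_xy, coef_xy]
  rcases Nat.eq_zero_or_pos i with rfl | hi
  · simp
  · by_cases h : n 0 = i - 1 ∧ n 1 = j
    · have hi' : n 0 + 1 = i := by omega
      rw [if_pos h, if_pos (by simp [hi', h.2]), ← hi']
      simp
    · rw [if_neg h, if_neg, zero_mul, smul_zero]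
      simp only [Finsupp.add_apply, Finsupp.single_eq_same]
      rintro ⟨h0, h1⟩
      exact h ⟨by omega, by simpa using h1⟩

lemma partialDeriv_one_xy (i j : ℕ) :
    partialDeriv 1 (x ^ i * y ^ j) = j * (x ^ i * y ^ (j - 1)) := by
  refine localRing_ext fun n => ?_
  rw [coef_partialDeriv, ← nsmul_eq_mul, map_nsmul, coef_xy, coef_xy]
  rcases Nat.eq_zero_or_pos j with rfl | hj
  · simp
  · by_cases h : n 0 = i ∧ n 1 = j - 1
    · have hj' : n 1 + 1 = j := by omega
      rw [if_pos h, if_pos (by simp [hj', h.1]), ← hj']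
      simp
    · rw [if_neg h, if_neg, zero_mul, smul_zero]
      simp only [Finsupp.add_apply, Finsupp.single_eq_same]
      rintro ⟨h0, h1⟩
      exact h ⟨by simpa using h0, by omega⟩

lemma partialDeriv_zero_x_pow (i : ℕ) : partialDeriv 0 (x ^ i) = i * x ^ (i - 1) := by
  simpa using partialDeriv_zero_xy i 0

lemma partialDeriv_one_x_pow (i : ℕ) : partialDeriv 1 (x ^ i) = 0 := by
  simpa using partialDeriv_one_xy i 0

lemma partialDeriv_zero_y_pow (j : ℕ) : partialDeriv 0 (y ^ j) = 0 := by
  simpa using partialDeriv_zero_xy 0 j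

lemma partialDeriv_one_y_pow (j : ℕ) : partialDeriv 1 (y ^ j) = j * y ^ (j - 1) := by
  simpa using partialDeriv_one_xy 0 j

lemma partialDeriv_add (i : Fin 2) (f g : localRing) :
    partialDeriv i (f + g) = partialDeriv i f + partialDeriv i g :=
  map_add (partialDerivation i) f g

lemma partialDeriv_mul (i : Fin 2) (f g : localRing) :
    partialDeriv i (f * g) = f * partialDeriv i g + g * partialDeriv i f :=
  (partialDerivation i).leibniz f g

/-! ### Values near the origin -/

lemma summable_norm_value_term {f : localRing} {r : ℝ≥0} (hf : majorant r f.1 ≠ ∞)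
    {P : Fin 2 → ℂ} (hP : ∀ i, ‖P i‖ ≤ r) :
    Summable fun n : Fin 2 →₀ ℕ => ‖MvPowerSeries.coeff n f.1 * (P 0 ^ n 0 * P 1 ^ n 1)‖ := by
  refine Summable.of_nonneg_of_le (fun n => norm_nonneg _) (fun n => ?_)
    ((majorant_ne_top_iff _ _).1 hf)
  rw [norm_mul, norm_mul, norm_pow, norm_pow, pow_add]
  gcongr
  · exact hP 0
  · exact hP 1

lemma value_add {f g : localRing} {r : ℝ≥0} (hf : majorant r f.1 ≠ ∞) (hg : majorant r g.1 ≠ ∞)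
    {P : Fin 2 → ℂ} (hP : ∀ i, ‖P i‖ ≤ r) : value (f + g) P = value f P + value g P := by
  simp only [value]
  rw [← (summable_norm_value_term hf hP).of_norm.tsum_add
    (summable_norm_value_term hg hP).of_norm]
  refine tsum_congr fun n => ?_
  have : (f + g).1 = f.1 + g.1 := rfl
  rw [this, map_add, add_mul]

lemma value_mul {f g : localRing} {r : ℝ≥0} (hf : majorant r f.1 ≠ ∞) (hg : majorant r g.1 ≠ ∞)
    {P : Fin 2 → ℂ} (hP : ∀ i, ‖P i‖ ≤ r) : value (f * g) P = value f P * value g P := by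
  classical
  have hf' := summable_norm_value_term hf hP
  have hg' := summable_norm_value_term hg hP
  have hfg := summable_mul_of_summable_norm hf' hg'
  have h := hf'.of_norm.tsum_mul_tsum_eq_tsum_sum_antidiagonal hg'.of_norm hfg
  refine Eq.trans ?_ h.symm
  refine tsum_congr fun n => ?_
  have : (f * g).1 = f.1 * g.1 := rfl
  rw [this, MvPowerSeries.coeff_mul, Finset.sum_mul]
  refine Finset.sum_congr rfl fun p hp => ?_
  obtain rfl := Finset.HasAntidiagonal.mem_antidiagonal.mp hp
  simp only [Finsupp.add_apply, pow_add]
  ring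

lemma value_xy (i j : ℕ) (P : Fin 2 → ℂ) : value (x ^ i * y ^ j) P = P 0 ^ i * P 1 ^ j := by
  classical
  rw [value, tsum_eq_single (expo i j)]
  · rw [← coef_apply, coef_xy]
    simp
  · intro n hn
    rw [← coef_apply, coef_xy, if_neg, zero_mul]
    rintro ⟨rfl, rfl⟩
    exact hn (expo_eta n).symm

/-- On a polydisc where the generators and the two cofactors all converge absolutely, evaluation
respects the sum and products expressing `h`. -/
lemma exists_value_eq_zero_of_mem_span_pair {f g h : localRing} (hmem : h ∈ Ideal.span {f, g}) :
    ∃ r : ℝ≥0, 0 < r ∧ ∀ P : Fin 2 → ℂ, (∀ i, ‖P i‖ ≤ r) → value f P = 0 → value g P = 0 →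
      value h P = 0 := by
  obtain ⟨A, B, rfl⟩ := Ideal.mem_span_pair.1 hmem
  obtain ⟨r1, h1, H1⟩ := exists_majorant_lt_top A
  obtain ⟨r2, h2, H2⟩ := exists_majorant_lt_top B
  obtain ⟨r3, h3, H3⟩ := exists_majorant_lt_top f
  obtain ⟨r4, h4, H4⟩ := exists_majorant_lt_top g
  set r := min (min r1 r2) (min r3 r4) with hr
  have hA : majorant r A.1 ≠ ∞ := ne_top_of_le_ne_top (H1 r1 le_rfl).2
    (H1 r ((min_le_left _ _).trans (min_le_left _ _))).1
  have hB : majorant r B.1 ≠ ∞ := ne_top_of_le_ne_top (H2 r2 le_rfl).2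
    (H2 r ((min_le_left _ _).trans (min_le_right _ _))).1
  have hf : majorant r f.1 ≠ ∞ := ne_top_of_le_ne_top (H3 r3 le_rfl).2
    (H3 r ((min_le_right _ _).trans (min_le_left _ _))).1
  have hg : majorant r g.1 ≠ ∞ := ne_top_of_le_ne_top (H4 r4 le_rfl).2
    (H4 r ((min_le_right _ _).trans (min_le_right _ _))).1
  refine ⟨r, lt_min (lt_min h1 h2) (lt_min h3 h4), fun P hP hfP hgP => ?_⟩
  have hAf : majorant r (A * f).1 ≠ ∞ :=
    ne_top_of_le_ne_top (ENNReal.mul_ne_top hA hf) (majorant_mul_le r A.1 f.1)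
  have hBg : majorant r (B * g).1 ≠ ∞ :=
    ne_top_of_le_ne_top (ENNReal.mul_ne_top hB hg) (majorant_mul_le r B.1 g.1)
  rw [value_add hAf hBg hP, value_mul hA hf hP, value_mul hB hg hP, hfP, hgP]
  simp

/-- Near the origin a common zero of the partial derivatives is also a zero of `x^N` and `y^N`,
hence is the origin. -/
lemma isIsolatedSingularity_of_pow_mem {f : localRing} (h0 : valueAtZero f = 0)
    (hd : ∀ i, valueAtZero (partialDeriv i f) = 0) {N : ℕ}
    (hx : x ^ N ∈ jacobianIdeal f) (hy : y ^ N ∈ jacobianIdeal f) :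
    IsIsolatedSingularity f := by
  refine ⟨h0, hd, ?_⟩
  obtain ⟨r1, hr1, H1⟩ := exists_value_eq_zero_of_mem_span_pair hx
  obtain ⟨r2, hr2, H2⟩ := exists_value_eq_zero_of_mem_span_pair hy
  have hball : ∀ᶠ P : Fin 2 → ℂ in 𝓝 0, ‖P‖ < min r1 r2 := by
    have := Metric.ball_mem_nhds (0 : Fin 2 → ℂ) (ε := ((min r1 r2 : ℝ≥0) : ℝ))
      (by exact_mod_cast lt_min hr1 hr2)
    filter_upwards [this] with P hP
    rw [mem_ball_zero_iff] at hP
    exact_mod_cast hP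
  filter_upwards [nhdsWithin_le_nhds hball, self_mem_nhdsWithin] with P hP hne h
  apply hne
  have e1 := H1 P (fun i => (norm_le_pi_norm P i).trans
    (hP.le.trans (by exact_mod_cast min_le_left r1 r2))) (h.2 0) (h.2 1)
  have e2 := H2 P (fun i => (norm_le_pi_norm P i).trans
    (hP.le.trans (by exact_mod_cast min_le_right r1 r2))) (h.2 0) (h.2 1)
  have v1 := value_xy N 0 P
  have v2 := value_xy 0 N P
  rw [pow_zero, mul_one, e1, pow_zero, mul_one] at v1
  rw [pow_zero, one_mul, e2, pow_zero, one_mul] at v2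
  funext i
  fin_cases i
  · exact eq_zero_of_pow_eq_zero (n := N) v1.symm
  · exact eq_zero_of_pow_eq_zero (n := N) v2.symm

/-! ### Milnor and Tjurina numbers of semi-quasihomogeneous germs -/

lemma span_pair_mul_units {u v : localRing} {c d : ℂ} (hc : c ≠ 0) (hd : d ≠ 0) :
    Ideal.span {algebraMap ℂ localRing c * u, algebraMap ℂ localRing d * v} =
      Ideal.span {u, v} := by
  have h1 : IsUnit (algebraMap ℂ localRing c) := (IsUnit.mk0 c hc).map _
  have h2 : IsUnit (algebraMap ℂ localRing d) := (IsUnit.mk0 d hd).map _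
  rw [Ideal.span_insert, Ideal.span_insert, Ideal.span_singleton_mul_left_unit h1,
    Ideal.span_singleton_mul_left_unit h2]

lemma span_singleton_sup_eq {J : Ideal localRing} {f w : localRing} {c : ℂ} (hc : c ≠ 0)
    (h : f - algebraMap ℂ localRing c * w ∈ J) : Ideal.span {f} ⊔ J = Ideal.span {w} ⊔ J := by
  have h1 : IsUnit (algebraMap ℂ localRing c) := (IsUnit.mk0 c hc).map _
  rw [← Ideal.span_singleton_mul_left_unit h1 w]
  refine le_antisymm (sup_le ?_ le_sup_right) (sup_le ?_ le_sup_right)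
  · rw [Ideal.span_singleton_le_iff_mem]
    have := Submodule.add_mem_sup (Ideal.mem_span_singleton_self (algebraMap ℂ localRing c * w)) h
    simpa using this
  · rw [Ideal.span_singleton_le_iff_mem]
    have := Submodule.add_mem_sup (Ideal.mem_span_singleton_self f) (neg_mem h)
    simpa using this

/-- Milnor and Tjurina numbers of a germ `f` whose partial derivatives are, up to nonzero
constants, semi-quasihomogeneous with corners `x ^ p`, `y ^ q`, and which is congruent to a nonzero
multiple of the monomial `w = x ^ s * y ^ t` modulo its Jacobian ideal. -/
theorem milnor_tjurina_of_corners {a b p q s t : ℕ} {f u v u' v' : localRing} {c d γ : ℂ}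
    (ha : 0 < a) (hb : 0 < b) (hs : s ≤ p) (ht : t ≤ q)
    (hc : c ≠ 0) (hd : d ≠ 0) (hγ : γ ≠ 0)
    (hfx : partialDeriv 0 f = algebraMap ℂ localRing c * u)
    (hfy : partialDeriv 1 f = algebraMap ℂ localRing d * v)
    (hf : f - algebraMap ℂ localRing γ * (x ^ s * y ^ t) ∈ Ideal.span {u, v})
    (hu : u - x ^ p ∈ weightIdeal a b (a * p + 1))
    (hv : v - y ^ q ∈ weightIdeal a b (b * q + 1))
    (hu' : u' - x ^ (p - s) ∈ weightIdeal a b (a * (p - s) + 1))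
    (hv' : v' - y ^ (q - t) ∈ weightIdeal a b (b * (q - t) + 1))
    (hwu : x ^ s * y ^ t * u' ∈ Ideal.span {u, v})
    (hwv : x ^ s * y ^ t * v' ∈ Ideal.span {u, v})
    (hf0 : valueAtZero f = 0) (hu0 : valueAtZero u = 0) (hv0 : valueAtZero v = 0) :
    IsIsolatedSingularity f ∧ FiniteDimensional ℂ (MilnorAlgebra f) ∧
      FiniteDimensional ℂ (TjurinaAlgebra f) ∧ milnorNumber f = p * q ∧
      tjurinaNumber f + (p - s) * (q - t) = p * q := by
  have hJ : jacobianIdeal f = Ideal.span {u, v} := by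
    rw [jacobianIdeal, hfx, hfy, span_pair_mul_units hc hd]
  have hT : Ideal.span {f} ⊔ jacobianIdeal f =
      Ideal.span {x ^ s * y ^ t} ⊔ Ideal.span {u, v} := by
    rw [hJ, span_singleton_sup_eq hγ hf]
  have hM := finrank_quotient_span_pair ha hb hu hv
  have hTj := finrank_quotient_span_monomial_sup ha hb hs ht hu hv hu' hv' hwu hwv
  rw [← hJ] at hM
  rw [← hT] at hTj
  refine ⟨?_, hM.1, hTj.1, hM.2, hTj.2⟩
  -- Since both weights are positive, `x^N` and `y^N` have weight at least `N = ap + bq`, the bound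
  -- beyond which every germ lies in `(u, v)`.
  refine isIsolatedSingularity_of_pow_mem (N := a * p + b * q) hf0 (fun i => ?_) ?_ ?_
  · fin_cases i
    · simp only [Fin.zero_eta, hfx]
      simp only [← valueAtZeroHom_apply] at *
      simp [hu0]
    · simp only [Fin.mk_one, hfy]
      simp only [← valueAtZeroHom_apply] at *
      simp [hv0]
  · rw [hJ]
    refine weightIdeal_le_span_pair ha hb hu hv ?_
    have := xy_mem_weightIdeal (a := a) (b := b) (k := a * p + b * q) (i := a * p + b * q) (j := 0)
      (by rw [mul_zero, add_zero]; exact Nat.le_mul_of_pos_left _ ha)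
    simpa using this
  · rw [hJ]
    refine weightIdeal_le_span_pair ha hb hu hv ?_
    have := xy_mem_weightIdeal (a := a) (b := b) (k := a * p + b * q) (i := 0) (j := a * p + b * q)
      (by rw [mul_zero, zero_add]; exact Nat.le_mul_of_pos_left _ hb)
    simpa using this

/-! ### Milnor and Tjurina numbers of the two families -/

lemma algebraMap_mul_xy_mem_weightIdeal {a b k i j : ℕ} (c : ℂ) (h : k ≤ a * i + b * j) :
    algebraMap ℂ localRing c * (x ^ i * y ^ j) ∈ weightIdeal a b k :=
  Ideal.mul_mem_left _ _ (xy_mem_weightIdeal h)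

/-- Here `m = k + 2`, so that the exponent `m - 2 = k` of the corner `y^(q-t)` is a natural number.
For `m = 2` that corner is `1`, and nothing is subtracted from `μ`. -/
theorem irreducibleFamily_invariants (k : ℕ) :
    IsIsolatedSingularity (irreducibleFamily (k + 2)) ∧
      FiniteDimensional ℂ (MilnorAlgebra (irreducibleFamily (k + 2))) ∧
      FiniteDimensional ℂ (TjurinaAlgebra (irreducibleFamily (k + 2))) ∧
      milnorNumber (irreducibleFamily (k + 2)) = (2 * k + 4) * (2 * k + 3) ∧
      tjurinaNumber (irreducibleFamily (k + 2)) +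
        (2 * k + 4 - (k + 2)) * (2 * k + 3 - (k + 3)) = (2 * k + 4) * (2 * k + 3) := by
  have hk5 : (2 * k + 5 : ℂ) ≠ 0 := by exact_mod_cast (by omega : 2 * k + 5 ≠ 0)
  have hk4 : (2 * k + 4 : ℂ) ≠ 0 := by exact_mod_cast (by omega : 2 * k + 4 ≠ 0)
  set α : ℂ := (k + 2) / (2 * k + 5) with hα
  set β : ℂ := (k + 3) / (2 * k + 4) with hβ
  set A := algebraMap ℂ localRing α with hA
  set B := algebraMap ℂ localRing β with hB
  have e1 : algebraMap ℂ localRing (2 * k + 5) * A = k + 2 := by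
    rw [hA, ← map_mul, hα, mul_div_cancel₀ _ hk5, map_add, map_natCast, map_ofNat]
  have e2 : algebraMap ℂ localRing (2 * k + 4) * B = k + 3 := by
    rw [hB, ← map_mul, hβ, mul_div_cancel₀ _ hk4, map_add, map_natCast, map_ofNat]
  have e3 : algebraMap ℂ localRing (2 * k + 5) = 2 * k + 5 := by
    simp only [map_add, map_mul, map_natCast, map_ofNat]
  have e4 : algebraMap ℂ localRing (2 * k + 4) = 2 * k + 4 := by
    simp only [map_add, map_mul, map_natCast, map_ofNat]
  have e5 : algebraMap ℂ localRing (1 - α - β) = 1 - A - B := by simp [hA, hB]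
  have e6 : algebraMap ℂ localRing (-(α * β)) = -(A * B) := by simp [hA, hB]
  have e7 : algebraMap ℂ localRing (α * β ^ 2) = A * B ^ 2 := by simp [hA, hB]
  have hγ : 1 - α - β ≠ 0 := by
    intro h
    have eα : α * (2 * k + 5) = k + 2 := div_mul_cancel₀ _ hk5
    have eβ : β * (2 * k + 4) = k + 3 := div_mul_cancel₀ _ hk4
    have h' : ((2 * k + 5) * (2 * k + 4) : ℂ) = (k + 2) * (2 * k + 4) + (k + 3) * (2 * k + 5) := by
      linear_combination (2 * k + 5 : ℂ) * (2 * k + 4) * h + (2 * k + 4 : ℂ) * eα +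
        (2 * k + 5 : ℂ) * eβ
    -- The right-hand side exceeds the left by `k + 3`.
    have h'' : (2 * k + 5) * (2 * k + 4) = (k + 2) * (2 * k + 4) + (k + 3) * (2 * k + 5) := by
      exact_mod_cast h'
    nlinarith
  -- The weights `2m` and `2m + 1` give `x^(2m+1)` and `y^(2m)` equal weight. The germs `u'` and
  -- `v'` are what remains after dividing combinations of `u` and `v` by `w = x^m y^(m+1)`.
  refine milnor_tjurina_of_corners (a := 2 * k + 4) (b := 2 * k + 5) (c := 2 * k + 5)
    (d := 2 * k + 4) (γ := 1 - α - β)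
    (u := x ^ (2 * k + 4) + A * (x ^ (k + 1) * y ^ (k + 3)))
    (v := y ^ (2 * k + 3) + B * (x ^ (k + 2) * y ^ (k + 2)))
    (u' := x ^ (k + 2) + algebraMap ℂ localRing (-(α * β)) * (x ^ (k + 1) * y ^ 2))
    (v' := y ^ k + algebraMap ℂ localRing (α * β ^ 2) * (x ^ (k + 1) * y ^ 1))
    (by omega) (by omega) (by omega) (by omega) hk5 hk4 hγ ?_ ?_ ?_ ?_ ?_ ?_ ?_ ?_ ?_ ?_ ?_ ?_
  · rw [irreducibleFamily, partialDeriv_add, partialDeriv_add, partialDeriv_zero_x_pow,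
      partialDeriv_zero_xy, partialDeriv_zero_y_pow,
      show 2 * (k + 2) + 1 - 1 = 2 * k + 4 by omega, show k + 2 - 1 = k + 1 by omega,
      show k + 2 + 1 = k + 3 by omega]
    simp only [Nat.cast_add, Nat.cast_mul, Nat.cast_ofNat, Nat.cast_one]
    linear_combination -(x ^ (k + 1) * y ^ (k + 3)) * e1 - x ^ (2 * k + 4) * e3
  · rw [irreducibleFamily, partialDeriv_add, partialDeriv_add, partialDeriv_one_x_pow,
      partialDeriv_one_xy, partialDeriv_one_y_pow,
      show 2 * (k + 2) - 1 = 2 * k + 3 by omega, show k + 2 + 1 - 1 = k + 2 by omega]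
    simp only [Nat.cast_add, Nat.cast_mul, Nat.cast_ofNat, Nat.cast_one]
    linear_combination -(x ^ (k + 2) * y ^ (k + 2)) * e2 - y ^ (2 * k + 3) * e4
  -- An Euler-type relation: `x u + y v` reproduces both pure powers exactly and differs from `f`
  -- only in the mixed monomial.
  · refine Ideal.mem_span_pair.2 ⟨x, y, ?_⟩
    rw [irreducibleFamily, e5]
    ring
  · rw [add_sub_cancel_left]
    exact algebraMap_mul_xy_mem_weightIdeal _ (by nlinarith)
  · rw [add_sub_cancel_left]
    exact algebraMap_mul_xy_mem_weightIdeal _ (by nlinarith)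
  · rw [show 2 * k + 4 - (k + 2) = k + 2 by omega, add_sub_cancel_left]
    exact algebraMap_mul_xy_mem_weightIdeal _ (by nlinarith)
  · rw [show 2 * k + 3 - (k + 3) = k by omega, add_sub_cancel_left]
    exact algebraMap_mul_xy_mem_weightIdeal _ (by nlinarith)
  -- The multiple of `v` cancels the term of `y^(k+3) u` containing `x` only to the power `k + 1`,
  -- which `w` does not divide.
  · refine Ideal.mem_span_pair.2 ⟨y ^ (k + 3), -(A * (x ^ (k + 1) * y ^ 3)), ?_⟩
    rw [e6]
    ring
  · refine Ideal.mem_span_pair.2 ⟨-(B * y ^ (k + 2)),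
      x ^ (k + 2) + A * B * (x ^ (k + 1) * y ^ 2), ?_⟩
    rw [e7]
    ring
  · simp only [← valueAtZeroHom_apply, irreducibleFamily]
    simp
  · simp only [← valueAtZeroHom_apply]
    simp
  · simp only [← valueAtZeroHom_apply]
    simp

/-- Here `m = k + 1`, both weights are `1`, and `w = x^(m+1) y^(m+1)`; the corners of the
annihilator are `x^(m-1)` and `y^(m-1)`, which equal `1` when `m = 1`. -/
theorem transversalFamily_invariants (k : ℕ) :
    IsIsolatedSingularity (transversalFamily (k + 1)) ∧
      FiniteDimensional ℂ (MilnorAlgebra (transversalFamily (k + 1))) ∧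
      FiniteDimensional ℂ (TjurinaAlgebra (transversalFamily (k + 1))) ∧
      milnorNumber (transversalFamily (k + 1)) = (2 * k + 2) * (2 * k + 2) ∧
      tjurinaNumber (transversalFamily (k + 1)) +
        (2 * k + 2 - (k + 2)) * (2 * k + 2 - (k + 2)) = (2 * k + 2) * (2 * k + 2) := by
  have hk3 : (2 * k + 3 : ℂ) ≠ 0 := by exact_mod_cast (by omega : 2 * k + 3 ≠ 0)
  set α : ℂ := (k + 2) / (2 * k + 3) with hα
  set A := algebraMap ℂ localRing α with hA
  have e1 : algebraMap ℂ localRing (2 * k + 3) * A = k + 2 := by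
    rw [hA, ← map_mul, hα, mul_div_cancel₀ _ hk3, map_add, map_natCast, map_ofNat]
  have e3 : algebraMap ℂ localRing (2 * k + 3) = 2 * k + 3 := by
    simp only [map_add, map_mul, map_natCast, map_ofNat]
  have e5 : algebraMap ℂ localRing (1 - 2 * α) = 1 - 2 * A := by
    simp only [hA, map_sub, map_mul, map_one, map_ofNat]
  have e6 : algebraMap ℂ localRing (-(α ^ 2)) = -A ^ 2 := by simp [hA]
  have hγ : 1 - 2 * α ≠ 0 := by
    have : 1 - 2 * α = -1 / (2 * k + 3) := by
      rw [hα]; field_simp; ring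
    rw [this]
    exact div_ne_zero (by norm_num) hk3
  refine milnor_tjurina_of_corners (a := 1) (b := 1) (c := 2 * k + 3)
    (d := 2 * k + 3) (γ := 1 - 2 * α)
    (u := x ^ (2 * k + 2) + A * (x ^ (k + 1) * y ^ (k + 2)))
    (v := y ^ (2 * k + 2) + A * (x ^ (k + 2) * y ^ (k + 1)))
    (u' := x ^ k + algebraMap ℂ localRing (-(α ^ 2)) * (x ^ (k + 1) * y ^ 1))
    (v' := y ^ k + algebraMap ℂ localRing (-(α ^ 2)) * (x ^ 1 * y ^ (k + 1)))
    (by omega) (by omega) (by omega) (by omega) hk3 hk3 hγ ?_ ?_ ?_ ?_ ?_ ?_ ?_ ?_ ?_ ?_ ?_ ?_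
  · rw [transversalFamily, partialDeriv_add, partialDeriv_add, partialDeriv_zero_x_pow,
      partialDeriv_zero_xy, partialDeriv_zero_y_pow,
      show 2 * (k + 1) + 1 - 1 = 2 * k + 2 by omega, show k + 1 + 1 - 1 = k + 1 by omega]
    simp only [Nat.cast_add, Nat.cast_mul, Nat.cast_ofNat, Nat.cast_one]
    linear_combination -(x ^ (k + 1) * y ^ (k + 2)) * e1 - x ^ (2 * k + 2) * e3
  · rw [transversalFamily, partialDeriv_add, partialDeriv_add, partialDeriv_one_x_pow,
      partialDeriv_one_xy, partialDeriv_one_y_pow,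
      show 2 * (k + 1) + 1 - 1 = 2 * k + 2 by omega, show k + 1 + 1 - 1 = k + 1 by omega]
    simp only [Nat.cast_add, Nat.cast_mul, Nat.cast_ofNat, Nat.cast_one]
    linear_combination -(x ^ (k + 2) * y ^ (k + 1)) * e1 - y ^ (2 * k + 2) * e3
  · refine Ideal.mem_span_pair.2 ⟨x, y, ?_⟩
    rw [transversalFamily, e5]
    ring
  · rw [add_sub_cancel_left]
    exact algebraMap_mul_xy_mem_weightIdeal _ (by omega)
  · rw [add_sub_cancel_left]
    exact algebraMap_mul_xy_mem_weightIdeal _ (by omega)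
  · rw [show 2 * k + 2 - (k + 2) = k by omega, add_sub_cancel_left]
    exact algebraMap_mul_xy_mem_weightIdeal _ (by omega)
  · rw [show 2 * k + 2 - (k + 2) = k by omega, add_sub_cancel_left]
    exact algebraMap_mul_xy_mem_weightIdeal _ (by omega)
  · refine Ideal.mem_span_pair.2 ⟨y ^ (k + 2), -(A * (x ^ (k + 1) * y ^ 2)), ?_⟩
    rw [e6]
    ring
  · refine Ideal.mem_span_pair.2 ⟨-(A * (x ^ 2 * y ^ (k + 1))), x ^ (k + 2), ?_⟩
    rw [e6]
    ring
  · simp only [← valueAtZeroHom_apply, transversalFamily]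
    simp
  · simp only [← valueAtZeroHom_apply]
    simp
  · simp only [← valueAtZeroHom_apply]
    simp

/-! ### Irreducibility -/

lemma weight_pair (a b : ℕ) (n : Fin 2 →₀ ℕ) :
    Finsupp.weight ![a, b] n = a * n 0 + b * n 1 := by
  simp [Finsupp.weight_apply, Finsupp.sum_fintype, mul_comm]

/-- Weighted orders add under multiplication, so in `f = gh` the two end points of the Newton edge
split into end points for `g` and `h` of minimal weight. Equating the weights of those of `g` and
using that `2m` and `2m + 1` are coprime forces one factor to have a nonzero constant term. -/
theorem irreducible_irreducibleFamily {m : ℕ} (hm : 1 ≤ m) : Irreducible (irreducibleFamily m) := by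
  classical
  set f := irreducibleFamily m with hf
  have hcoef : ∀ n, coef n f = (if n 0 = 2 * m + 1 ∧ n 1 = 0 then 1 else 0) +
      (if n 0 = m ∧ n 1 = m + 1 then 1 else 0) + (if n 0 = 0 ∧ n 1 = 2 * m then 1 else 0) := by
    intro n
    have h1 := coef_xy n (2 * m + 1) 0
    have h2 := coef_xy n 0 (2 * m)
    rw [pow_zero, mul_one] at h1
    rw [pow_zero, one_mul] at h2
    rw [hf, irreducibleFamily, map_add, map_add, coef_xy, h1, h2]
  refine ⟨fun hunit => ?_, fun g h hgh => ?_⟩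
  · rw [isUnit_iff_valueAtZero_ne_zero, ← coef_zero, hcoef] at hunit
    exact hunit (by simp; omega)
  · set w : Fin 2 → ℕ := ![2 * m, 2 * m + 1] with hw
    have hwo : ((2 * m * (2 * m + 1) : ℕ) : ℕ∞) ≤
        g.1.weightedOrder w + h.1.weightedOrder w := by
      rw [← MvPowerSeries.weightedOrder_mul]
      refine MvPowerSeries.le_weightedOrder w fun n hn => ?_
      have hn' : 2 * m * n 0 + (2 * m + 1) * n 1 < 2 * m * (2 * m + 1) := by
        rw [hw, weight_pair] at hn
        exact_mod_cast hn
      have e : g.1 * h.1 = f.1 := congrArg Subtype.val hgh.symm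
      rw [e, ← coef_apply, hcoef, if_neg, if_neg, if_neg]
      · simp
      · rintro ⟨h0, h1⟩; rw [h0, h1] at hn'; nlinarith
      · rintro ⟨h0, h1⟩; rw [h0, h1] at hn'; nlinarith
      · rintro ⟨h0, h1⟩; rw [h0, h1] at hn'; nlinarith
    have corner : ∀ n : Fin 2 →₀ ℕ, coef n f ≠ 0 → ∃ n₁ n₂ : Fin 2 →₀ ℕ, n₁ + n₂ = n ∧
        coef n₁ g ≠ 0 ∧ coef n₂ h ≠ 0 ∧
        g.1.weightedOrder w ≤ (2 * m * n₁ 0 + (2 * m + 1) * n₁ 1 : ℕ) ∧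
        h.1.weightedOrder w ≤ (2 * m * n₂ 0 + (2 * m + 1) * n₂ 1 : ℕ) := by
      intro n hn
      rw [hgh, coef_mul] at hn
      obtain ⟨p, hp, hne⟩ := Finset.exists_ne_zero_of_sum_ne_zero hn
      have hg := left_ne_zero_of_mul hne
      have hh := right_ne_zero_of_mul hne
      refine ⟨p.1, p.2, Finset.HasAntidiagonal.mem_antidiagonal.1 hp, hg, hh, ?_, ?_⟩
      · rw [← weight_pair]; exact MvPowerSeries.weightedOrder_le w hg
      · rw [← weight_pair]; exact MvPowerSeries.weightedOrder_le w hh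
    obtain ⟨s, t, hst, -, -, hs, ht⟩ := corner (expo (2 * m + 1) 0) (by rw [hcoef]; simp)
    obtain ⟨s', t', hst', hsg, hth, hs', ht'⟩ := corner (expo 0 (2 * m)) (by
      rw [hcoef]
      have h1 : ¬ (0 = m ∧ 2 * m = m + 1) := by omega
      simp only [expo_zero, expo_one]
      rw [if_neg (by omega), if_neg h1]
      simp)
    have a0 : s 0 + t 0 = 2 * m + 1 := by simpa using DFunLike.congr_fun hst 0
    have a1 : s 1 + t 1 = 0 := by simpa using DFunLike.congr_fun hst 1
    have b0 : s' 0 + t' 0 = 0 := by simpa using DFunLike.congr_fun hst' 0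
    have b1 : s' 1 + t' 1 = 2 * m := by simpa using DFunLike.congr_fun hst' 1
    obtain ⟨A, hA⟩ := ENat.ne_top_iff_exists.1 (ne_top_of_le_ne_top (ENat.natCast_ne_top _) hs)
    obtain ⟨B, hB⟩ := ENat.ne_top_iff_exists.1 (ne_top_of_le_ne_top (ENat.natCast_ne_top _) ht)
    rw [← hA] at hwo hs hs'
    rw [← hB] at hwo ht ht'
    norm_cast at hwo hs hs' ht ht'
    have s1 : s 1 = 0 := by omega
    have t1 : t 1 = 0 := by omega
    have s0' : s' 0 = 0 := by omega
    have t0' : t' 0 = 0 := by omega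
    rw [s1] at hs
    rw [t1] at ht
    rw [s0'] at hs'
    rw [t0'] at ht'
    have E1 : 2 * m * s 0 + 2 * m * t 0 = 2 * m * (2 * m + 1) := by rw [← mul_add, a0]
    have E2 : (2 * m + 1) * s' 1 + (2 * m + 1) * t' 1 = 2 * m * (2 * m + 1) := by
      rw [← mul_add, b1, mul_comm]
    -- Both sides equal the weighted order of `g`: each corner has weight `2m(2m+1)`, at most the
    -- sum of the two orders, so neither factor's contribution can exceed its order.
    have key : 2 * m * s 0 = (2 * m + 1) * s' 1 := by omega
    have hdvd : 2 * m ∣ s' 1 := by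
      have : 2 * m ∣ (2 * m + 1) * s' 1 := ⟨s 0, key.symm⟩
      exact (Nat.Coprime.dvd_of_dvd_mul_left (by simp) this)
    rcases Nat.eq_zero_or_pos (s' 1) with h0 | hpos
    · left
      rw [isUnit_iff_valueAtZero_ne_zero, ← coef_zero]
      have : s' = 0 := exponent_ext (by simpa using s0') (by simpa using h0)
      rwa [this] at hsg
    · right
      have := Nat.le_of_dvd hpos hdvd
      rw [isUnit_iff_valueAtZero_ne_zero, ← coef_zero]
      have : t' = 0 := exponent_ext (by simpa using t0') (by simp; omega)
      rwa [this] at hth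

/-- By the Leibniz rule, a product of two germs vanishing at the origin has zero gradient there. -/
lemma IsSmoothGerm.irreducible {g : localRing} (hg : IsSmoothGerm g) : Irreducible g := by
  obtain ⟨h0, i, hi⟩ := hg
  refine ⟨fun hunit => isUnit_iff_valueAtZero_ne_zero.1 hunit h0, fun a b hab => ?_⟩
  by_contra! hcon
  simp only [isUnit_iff_valueAtZero_ne_zero, not_not] at hcon
  apply hi
  rw [hab, partialDeriv_mul]
  simp only [← valueAtZeroHom_apply] at *
  simp [hcon.1, hcon.2]

/-! ### Smooth branches -/

/-- Two monic polynomials of degree `n` differ by one of degree less than `n`; vanishing at `n`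
distinct points of a domain makes the difference zero. -/
lemma monic_eq_prod_of_roots {R : Type*} [CommRing R] [IsDomain R] {n : ℕ} {P : Polynomial R}
    (hP : P.Monic) (hdeg : P.degree = n) {r : Fin n → R} (hr : Function.Injective r)
    (hroot : ∀ j, P.eval (r j) = 0) : P = ∏ j, (Polynomial.X - Polynomial.C (r j)) := by
  set Q := ∏ j, (Polynomial.X - Polynomial.C (r j)) with hQ
  have hQm : Q.Monic := Polynomial.monic_prod_of_monic _ _ fun j _ => Polynomial.monic_X_sub_C _
  have hQd : Q.degree = n := by
    rw [hQ, Polynomial.degree_prod]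
    simp
  refine Polynomial.eq_of_degree_sub_lt_of_eval_index_eq (v := r) Finset.univ hr.injOn ?_ ?_
  · have := Polynomial.degree_sub_lt_left (hdeg.trans hQd.symm) hP.ne_zero
      (by rw [hP.leadingCoeff, hQm.leadingCoeff])
    simpa [hdeg] using this
  · intro j _
    rw [hroot, hQ, Polynomial.eval_prod]
    exact (Finset.prod_eq_zero (Finset.mem_univ j) (by simp)).symm

/-- The slope functions of the branches of `x^{2m+1} + y^{2m+1} + x^{m+1} y^{m+1}`. -/
lemma exists_slope (m : ℕ) {ω : ℂ} (hω : ω ^ (2 * m + 1) = -1) :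
    ∃ t : localRing, valueAtZero t = ω ∧ t ^ (2 * m + 1) + 1 + y * t ^ (m + 1) = 0 := by
  have hω0 : ω ≠ 0 := by
    rintro rfl
    rw [zero_pow (by omega)] at hω
    norm_num at hω
  obtain ⟨t, ht, h⟩ := exists_root_of_simple_root
    (Polynomial.X ^ (2 * m + 1) + 1 + Polynomial.C y * Polynomial.X ^ (m + 1))
    (algebraMap ℂ localRing ω)
    (by
      simp only [← valueAtZeroHom_apply]
      simp [hω])
    (by
      have h2 : (2 * m + 1 : ℂ) ≠ 0 := by exact_mod_cast (by omega : 2 * m + 1 ≠ 0)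
      simp only [← valueAtZeroHom_apply]
      simpa [hω0, map_ofNat valueAtZeroHom 2] using h2)
  refine ⟨t, ?_, by simpa using h⟩
  rw [ht]
  simp only [← valueAtZeroHom_apply]
  simp

/-- The branches are `x = y t_j`, where `t_j` is the Hensel lift of the `j`-th root of `ω^(2m+1) =
-1`. Its gradient is `(1, -ω_j)`, so distinct roots give distinct tangents. -/
theorem hasSmoothTransversalBranches_transversalFamily {m : ℕ} (hm : 1 ≤ m) :
    HasSmoothTransversalBranches (transversalFamily m) := by
  set n := 2 * m + 1 with hn
  set ζ : ℂ := Complex.exp (2 * Real.pi * Complex.I / n) with hζ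
  have hprim : IsPrimitiveRoot ζ n := Complex.isPrimitiveRoot_exp n (by omega)
  set ω : Fin n → ℂ := fun j => -ζ ^ (j : ℕ) with hω
  have hωpow : ∀ j, ω j ^ n = -1 := by
    intro j
    rw [hω]
    simp only
    rw [Odd.neg_pow ⟨m, hn⟩, ← pow_mul, mul_comm, pow_mul, hprim.pow_eq_one, one_pow]
  have hωinj : Function.Injective ω := fun i j hij =>
    Fin.ext (hprim.pow_inj i.2 j.2 (neg_injective hij))
  choose t ht0 ht using fun j => exists_slope m (hωpow j)
  have hd0 : ∀ j, valueAtZero (partialDeriv 0 (x - y * t j)) = 1 := by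
    intro j
    have h1 := partialDeriv_zero_x_pow 1
    have h2 := partialDeriv_zero_y_pow 1
    rw [pow_one] at h1 h2
    have : partialDeriv 0 (x - y * t j) = 1 - y * partialDeriv 0 (t j) := by
      rw [← partialDerivation_apply, map_sub, partialDerivation_apply, partialDerivation_apply,
        partialDeriv_mul, h1, h2]
      simp
    rw [this]
    simp only [← valueAtZeroHom_apply]
    simp
  have hd1 : ∀ j, valueAtZero (partialDeriv 1 (x - y * t j)) = -ω j := by
    intro j
    have h1 := partialDeriv_one_x_pow 1
    have h2 := partialDeriv_one_y_pow 1
    rw [pow_one] at h1 h2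
    have : partialDeriv 1 (x - y * t j) = -(y * partialDeriv 1 (t j) + t j) := by
      rw [← partialDerivation_apply, map_sub, partialDerivation_apply, partialDerivation_apply,
        partialDeriv_mul, h1, h2]
      simp
    rw [this, ← ht0 j]
    simp only [← valueAtZeroHom_apply]
    simp
  have hsmooth : ∀ j, IsSmoothGerm (x - y * t j) := fun j =>
    ⟨by simp only [← valueAtZeroHom_apply]; simp, 0, by rw [hd0]; exact one_ne_zero⟩
  refine ⟨n, fun j => x - y * t j, ?_, fun j => (hsmooth j).irreducible, hsmooth,
    fun j k hjk => ?_⟩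
  -- The variable `x` is replaced by an indeterminate to use a factorization over the domain
  -- `localRing`; evaluating at the germ `x` afterwards recovers `f`. Here `m ≥ 1` keeps the mixed
  -- term below the leading degree.
  · set P : Polynomial localRing := Polynomial.X ^ n +
      (Polynomial.C (y ^ (m + 1)) * Polynomial.X ^ (m + 1) + Polynomial.C (y ^ n)) with hP
    have hlow : (Polynomial.C (y ^ (m + 1)) * Polynomial.X ^ (m + 1) +
        Polynomial.C (y ^ n)).degree < (n : WithBot ℕ) := by
      refine (Polynomial.degree_add_le _ _).trans_lt (max_lt ?_ ?_)
      · refine (Polynomial.degree_C_mul_X_pow_le _ _).trans_lt ?_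
        exact_mod_cast (by omega : m + 1 < n)
      · refine Polynomial.degree_C_le.trans_lt ?_
        exact_mod_cast (by omega : 0 < n)
    have hmonic : P.Monic := Polynomial.monic_X_pow_add hlow
    have hdeg : P.degree = n := by
      rw [hP, Polynomial.degree_add_eq_left_of_degree_lt (by rwa [Polynomial.degree_X_pow]),
        Polynomial.degree_X_pow]
    have hy0 : y ≠ 0 := by
      intro h
      have := coef_xy (expo 0 1) 0 1
      rw [pow_zero, one_mul, pow_one, h, map_zero] at this
      simp at this
    have : IsDomain localRing := NoZeroDivisors.to_isDomain _
    have hinj : Function.Injective fun j => y * t j := fun i j hij => by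
      have := mul_left_cancel₀ hy0 hij
      exact hωinj (by rw [← ht0 i, ← ht0 j, this])
    have hroot : ∀ j, P.eval (y * t j) = 0 := by
      intro j
      have e : P.eval (y * t j) = y ^ n * (t j ^ n + 1 + y * t j ^ (m + 1)) := by
        simp only [hP, Polynomial.eval_add, Polynomial.eval_mul, Polynomial.eval_pow,
          Polynomial.eval_X, Polynomial.eval_C, hn]
        ring
      rw [e, ht j, mul_zero]
    have hprod := congrArg (Polynomial.eval x) (monic_eq_prod_of_roots hmonic hdeg hinj hroot)
    have hx : P.eval x = transversalFamily m := by
      simp only [hP, Polynomial.eval_add, Polynomial.eval_mul, Polynomial.eval_pow,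
        Polynomial.eval_X, Polynomial.eval_C, transversalFamily, hn]
      ring
    rw [hx, Polynomial.eval_prod] at hprod
    simp only [Polynomial.eval_sub, Polynomial.eval_X, Polynomial.eval_C] at hprod
    rw [hprod]
  · rw [HasDistinctTangents, LinearIndependent.pair_iff]
    intro c d h
    have h0 := congrFun h 0
    have h1 := congrFun h 1
    simp only [Pi.add_apply, Pi.smul_apply, hd0, hd1, smul_eq_mul, Pi.zero_apply] at h0 h1
    have hne : ω j - ω k ≠ 0 := sub_ne_zero.2 fun h => hjk (hωinj h)
    have hc : c * (ω j - ω k) = 0 := by linear_combination -h1 - ω k * h0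
    have hc0 : c = 0 := (mul_eq_zero.1 hc).resolve_right hne
    exact ⟨hc0, by rw [hc0] at h0; simpa using h0⟩

/-! ### The quotients of the Milnor and Tjurina numbers -/

theorem milnorNumber_irreducibleFamily {m : ℕ} (hm : 2 ≤ m) :
    (milnorNumber (irreducibleFamily m) : ℤ) = 2 * (m : ℤ) * (2 * (m : ℤ) - 1) := by
  obtain ⟨k, rfl⟩ := Nat.exists_eq_add_of_le' hm
  rw [(irreducibleFamily_invariants k).2.2.2.1]
  push_cast
  ring

theorem tjurinaNumber_irreducibleFamily {m : ℕ} (hm : 2 ≤ m) :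
    tjurinaNumber (irreducibleFamily m) = 3 * m ^ 2 := by
  obtain ⟨k, rfl⟩ := Nat.exists_eq_add_of_le' hm
  have h := (irreducibleFamily_invariants k).2.2.2.2
  rw [show 2 * k + 4 - (k + 2) = k + 2 by omega, show 2 * k + 3 - (k + 3) = k by omega] at h
  nlinarith

theorem milnorNumber_transversalFamily {m : ℕ} (hm : 1 ≤ m) :
    milnorNumber (transversalFamily m) = 4 * m ^ 2 := by
  obtain ⟨k, rfl⟩ := Nat.exists_eq_add_of_le' hm
  rw [(transversalFamily_invariants k).2.2.2.1]
  ring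

theorem tjurinaNumber_transversalFamily {m : ℕ} (hm : 1 ≤ m) :
    (tjurinaNumber (transversalFamily m) : ℤ) = 4 * (m : ℤ) ^ 2 - ((m : ℤ) - 1) ^ 2 := by
  obtain ⟨k, rfl⟩ := Nat.exists_eq_add_of_le' hm
  have h := (transversalFamily_invariants k).2.2.2.2
  rw [show 2 * k + 2 - (k + 2) = k by omega] at h
  zify at h
  push_cast
  linarith

lemma rho_irreducibleFamily {m : ℕ} (hm : 2 ≤ m) :
    rho (irreducibleFamily m) = 4 / 3 - 2 / (3 * m) := by
  have h1 : (milnorNumber (irreducibleFamily m) : ℚ) = 2 * m * (2 * m - 1) := by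
    exact_mod_cast congrArg (Int.cast : ℤ → ℚ) (milnorNumber_irreducibleFamily hm)
  have h0 : (m : ℚ) ≠ 0 := by exact_mod_cast (by omega : m ≠ 0)
  rw [rho, h1, tjurinaNumber_irreducibleFamily hm]
  push_cast
  field_simp
  ring

/-- Dividing through by `m^2` leaves `m` only in `1 / m`, which makes both the monotonicity and the
limit visible. -/
lemma rho_transversalFamily {m : ℕ} (hm : 1 ≤ m) :
    rho (transversalFamily m) = 4 / (4 - (1 - 1 / m) ^ 2) := by
  have h1 : (tjurinaNumber (transversalFamily m) : ℚ) = 4 * m ^ 2 - (m - 1) ^ 2 := by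
    exact_mod_cast congrArg (Int.cast : ℤ → ℚ) (tjurinaNumber_transversalFamily hm)
  have h0 : (m : ℚ) ≠ 0 := by exact_mod_cast (by omega : m ≠ 0)
  rw [rho, h1, milnorNumber_transversalFamily hm]
  have e : (4 * m ^ 2 - (m - 1) ^ 2 : ℚ) = m ^ 2 * (4 - (1 - 1 / m) ^ 2) := by
    field_simp
  rw [e]
  push_cast
  rw [mul_comm (4 : ℚ), mul_div_mul_left _ _ (pow_ne_zero 2 h0)]

theorem strictMonoOn_rho_irreducibleFamily :
    StrictMonoOn (fun m : ℕ => rho (irreducibleFamily m)) (Set.Ici 2) := by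
  intro m hm n hn hmn
  rw [Set.mem_Ici] at hm hn
  simp only [rho_irreducibleFamily hm, rho_irreducibleFamily hn]
  have h0 : (0 : ℚ) < m := by exact_mod_cast (by omega : 0 < m)
  gcongr

theorem strictMonoOn_rho_transversalFamily :
    StrictMonoOn (fun m : ℕ => rho (transversalFamily m)) (Set.Ici 1) := by
  intro m hm n hn hmn
  rw [Set.mem_Ici] at hm hn
  simp only [rho_transversalFamily hm, rho_transversalFamily hn]
  have h0 : (1 : ℚ) ≤ m := by exact_mod_cast hm
  have h1 : (m : ℚ) < n := by exact_mod_cast hmn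
  have h2 : (1 : ℚ) / n < 1 / m := by gcongr
  have h3 : (1 : ℚ) / m ≤ 1 := by rw [div_le_one (by linarith)]; exact h0
  have h4 : (0 : ℚ) < 1 / n := by
    have : (0 : ℚ) < n := by linarith
    positivity
  refine div_lt_div_of_pos_left (by norm_num) ?_ ?_ <;> nlinarith

theorem tendsto_rho_irreducibleFamily :
    Tendsto (fun m : ℕ => (rho (irreducibleFamily m) : ℝ)) atTop (𝓝 (4 / 3)) := by
  have h : Tendsto (fun m : ℕ => (4 / 3 : ℝ) - 2 / 3 * (1 / (m : ℝ))) atTop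
      (𝓝 (4 / 3 - 2 / 3 * 0)) :=
    (tendsto_one_div_atTop_nhds_zero_nat.const_mul _).const_sub _
  rw [mul_zero, sub_zero] at h
  refine h.congr' ?_
  filter_upwards [eventually_ge_atTop 2] with m hm
  rw [rho_irreducibleFamily hm]
  push_cast
  rw [div_mul_div_comm, mul_one]

theorem tendsto_rho_transversalFamily :
    Tendsto (fun m : ℕ => (rho (transversalFamily m) : ℝ)) atTop (𝓝 (4 / 3)) := by
  have h : Tendsto (fun m : ℕ => (4 : ℝ) / (4 - (1 - 1 / (m : ℝ)) ^ 2)) atTop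
      (𝓝 (4 / (4 - (1 - 0) ^ 2))) :=
    tendsto_const_nhds.div
      (((tendsto_one_div_atTop_nhds_zero_nat.const_sub 1).pow 2).const_sub 4) (by norm_num)
  rw [show (4 : ℝ) / (4 - (1 - 0) ^ 2) = 4 / 3 by norm_num] at h
  refine h.congr' ?_
  filter_upwards [eventually_ge_atTop 1] with m hm
  rw [rho_transversalFamily hm]
  push_cast
  rfl

end

end PlaneCurve

/-! ### Assembly of the main theorem -/

theorem mainTheorem2 :
    -- existence of a sequence with `ρ` strictly increasing to `4/3`
    (∃ f : ℕ → PlaneCurve.localRing,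
      (∀ k, PlaneCurve.IsIsolatedSingularity (f k) ∧
        FiniteDimensional ℂ (PlaneCurve.MilnorAlgebra (f k)) ∧
        FiniteDimensional ℂ (PlaneCurve.TjurinaAlgebra (f k))) ∧
      StrictMono (fun k => PlaneCurve.rho (f k)) ∧
      Tendsto (fun k => (PlaneCurve.rho (f k) : ℝ)) atTop (𝓝 (4 / 3))) ∧
    -- the irreducible family, `m ≥ 2`
    ((∀ m : ℕ, 2 ≤ m →
        PlaneCurve.IsIsolatedSingularity (PlaneCurve.irreducibleFamily m) ∧
        Irreducible (PlaneCurve.irreducibleFamily m) ∧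
        FiniteDimensional ℂ (PlaneCurve.MilnorAlgebra (PlaneCurve.irreducibleFamily m)) ∧
        FiniteDimensional ℂ (PlaneCurve.TjurinaAlgebra (PlaneCurve.irreducibleFamily m)) ∧
        PlaneCurve.tjurinaNumber (PlaneCurve.irreducibleFamily m) = 3 * m ^ 2 ∧
        (PlaneCurve.milnorNumber (PlaneCurve.irreducibleFamily m) : ℤ)
          = 2 * (m : ℤ) * (2 * (m : ℤ) - 1)) ∧
      StrictMonoOn (fun m : ℕ => PlaneCurve.rho (PlaneCurve.irreducibleFamily m)) (Set.Ici 2) ∧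
      Tendsto (fun m : ℕ => (PlaneCurve.rho (PlaneCurve.irreducibleFamily m) : ℝ))
        atTop (𝓝 (4 / 3))) ∧
    -- the family with smooth branches and distinct tangents, `m ≥ 1`
    ((∀ m : ℕ, 1 ≤ m →
        PlaneCurve.IsIsolatedSingularity (PlaneCurve.transversalFamily m) ∧
        PlaneCurve.HasSmoothTransversalBranches (PlaneCurve.transversalFamily m) ∧
        FiniteDimensional ℂ (PlaneCurve.MilnorAlgebra (PlaneCurve.transversalFamily m)) ∧
        FiniteDimensional ℂ (PlaneCurve.TjurinaAlgebra (PlaneCurve.transversalFamily m)) ∧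
        PlaneCurve.milnorNumber (PlaneCurve.transversalFamily m) = 4 * m ^ 2 ∧
        (PlaneCurve.tjurinaNumber (PlaneCurve.transversalFamily m) : ℤ)
          = 4 * (m : ℤ) ^ 2 - ((m : ℤ) - 1) ^ 2) ∧
      StrictMonoOn (fun m : ℕ => PlaneCurve.rho (PlaneCurve.transversalFamily m)) (Set.Ici 1) ∧
      Tendsto (fun m : ℕ => (PlaneCurve.rho (PlaneCurve.transversalFamily m) : ℝ))
        atTop (𝓝 (4 / 3))) := by
  refine ⟨⟨fun k => PlaneCurve.irreducibleFamily (k + 2), fun k => ?_, fun i j hij => ?_, ?_⟩,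
    ⟨fun m hm => ?_, PlaneCurve.strictMonoOn_rho_irreducibleFamily,
      PlaneCurve.tendsto_rho_irreducibleFamily⟩,
    ⟨fun m hm => ?_, PlaneCurve.strictMonoOn_rho_transversalFamily,
      PlaneCurve.tendsto_rho_transversalFamily⟩⟩
  · obtain ⟨h1, h2, h3, -, -⟩ := PlaneCurve.irreducibleFamily_invariants k
    exact ⟨h1, h2, h3⟩
  · exact PlaneCurve.strictMonoOn_rho_irreducibleFamily (Set.mem_Ici.2 (by omega))
      (Set.mem_Ici.2 (by omega)) (by omega)
  · exact PlaneCurve.tendsto_rho_irreducibleFamily.comp (tendsto_add_atTop_nat 2)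
  · have hτ := PlaneCurve.tjurinaNumber_irreducibleFamily hm
    have hμ := PlaneCurve.milnorNumber_irreducibleFamily hm
    have hirr := PlaneCurve.irreducible_irreducibleFamily (by omega : 1 ≤ m)
    obtain ⟨k, rfl⟩ := Nat.exists_eq_add_of_le' hm
    obtain ⟨h1, h2, h3, -, -⟩ := PlaneCurve.irreducibleFamily_invariants k
    exact ⟨h1, hirr, h2, h3, hτ, hμ⟩
  · have hτ := PlaneCurve.tjurinaNumber_transversalFamily hm
    have hμ := PlaneCurve.milnorNumber_transversalFamily hm
    have hbr := PlaneCurve.hasSmoothTransversalBranches_transversalFamily hm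
    obtain ⟨k, rfl⟩ := Nat.exists_eq_add_of_le' hm
    obtain ⟨h1, h2, h3, -, -⟩ := PlaneCurve.transversalFamily_invariants k
    exact ⟨h1, hbr, h2, h3, hμ, hτ⟩
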